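/- Let $n\ge 2$ and let $O_n$ be the Cuntz algebra, the universal $C^*$-algebra generated by $n$ isometries $S_1,\dots,S_n$ with $\sum_i S_iS_i^*=1$. For a word $\mu=\mu_1\cdots\mu_k$ put $S_\mu=S_{\mu_1}\cdots S_{\mu_k}$, $|\mu|=k$, and let $O_{nc}=\operatorname{span}\{S_\mu S_\nu^*\}$. Let $\sigma_z(S_i)=zS_i$ $(|z|=1)$ be the gauge action, $F$ its fixed-point algebra, $\Phi(a)=\frac1{2\pi}\int_0^{2\pi}\sigma_{e^{i\theta}}(a)\,d\theta$ the expectation of $O_n$ onto $F$, $\tau$ the unique faithful normalised trace on $F$, and $\psi=\tau\circ\Phi$. Let $\mathcal H=L^2(O_n,\psi)$ be the GNS space, with $\langle a,b\rangle=\psi(a^*b)$, and let $\pi$ be the representation of $O_n$ on $\mathcal H$ by left multiplication. Let $\mathcal D$ be the generator of the unitary action of the circle on $\mathcal H$ that implements $\sigma$, let $\Phi_k$ $(k\in\mathbb Z)$ be the projection onto its $k$-th spectral subspace (so $\mathcal D=\sum_k k\Phi_k$), and let $\Delta=\mathcal F\mathcal S$ be the modular operator, where $\mathcal S$ is the closure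 of $a\mapsto a^*$ on $O_{nc}$ and $\mathcal F$ is its adjoint. Let $\mathcal N\subset B(\mathcal H)$ be the double commutant of the set of operators that extend finite sums of the maps $z\mapsto x\Phi(y^*z)$, $x,y\in O_{nc}$. Put $$\tilde\tau(T)=\langle 1,T1\rangle+\sum_{|\mu|\ge1}\Big(\langle S_\mu,TS_\mu\rangle+\tfrac1{n^{|\mu|}}\langle S_\mu^*,TS_\mu^*\rangle\Big),\qquad \Delta_N=\Delta\sum_{|k|\le N}\Phi_k,\qquad \tau_\Delta(T)=\lim_{N\to\infty}\tilde\tau(\Delta_NT)$$ whenever this limit exists (for $T\ge0$ it is the supremum, possibly $\infty$). Let $\tilde\omega$ be a state on $L^\infty(\mathbb R_+)$ such that $\liminf_{t\to\infty}g(t)\le\tilde\omega(g)\le\limsup_{t\to\infty}g(t)$ (essential lower and upper limits) for every real-valued $g$. For a measurable function $g$ that is essentially bounded near $\infty$, write $\tilde\omega\text{-}\lim_{r\to\infty}g(r)$ for the value of $\tilde\omega$ on any element of $L^\infty(\mathbb R_+)$ that agrees with $g$ near $\infty$, which does not depend on the choice; and write $\tilde\omega\text{-}\lim_{s\to1^+}h(s)=\tilde\omega\text{-}\lim_{r\to\infty}h(1+1/r)$.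 Then for all $T\in\mathcal N$ and $s>1$ the number $\tau_\Delta(T(1+\mathcal D^2)^{-s/2})\in\mathbb C$ exists, for every $T\in\mathcal N$ the generalised limit $$\widehat\tau_\omega(T)=\tfrac12\,\tilde\omega\text{-}\lim_{s\to1^+}(s-1)\,\tau_\Delta\big(T(1+\mathcal D^2)^{-s/2}\big)$$ exists, and $\widehat\tau_\omega$ is a state on the von Neumann algebra $\mathcal N$. Moreover, $\pi(O_n)\subset\mathcal N$, and for every $a\in O_n$ the following ordinary limit exists and $$\widehat\tau_\omega(\pi(a))=\tfrac12\lim_{s\to1^+}(s-1)\,\tau_\Delta\big(\pi(a)(1+\mathcal D^2)^{-s/2}\big)=\tau\circ\Phi(a)=\psi(a).$$ -/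

import Mathlib

open scoped ENNReal ComplexOrder InnerProductSpace Topology
open MeasureTheory Filter

noncomputable section
namespace Cuntz

/-- The Cuntz relations: `n` isometries with `∑ i, S i * (S i)* = 1`. -/
structure IsCuntzFamily {n : ℕ} {B : Type*} [Ring B] [StarRing B] (S : Fin n → B) : Prop where
  isometry : ∀ i, star (S i) * S i = 1
  sum_range : ∑ i, S i * star (S i) = 1

/-- The Hilbert space `ℓ²(ℕ)`. -/
abbrev SeqSpace : Type := lp (fun _ : ℕ => ℂ) 2

instance : Nontrivial SeqSpace :=
  ⟨lp.single 2 0 1, 0, fun h => by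
    have := congrArg (fun f : SeqSpace => f 0) h
    simp at this⟩

/-- The representations of the Cuntz relations on `ℓ²(ℕ)`. Every separable nonzero Hilbert space
carrying `n ≥ 2` Cuntz isometries is isomorphic to `ℓ²(ℕ)`, and every representation of the relations
is a direct sum of separable ones, so these representations already compute the universal norm. -/
def CuntzRep (n : ℕ) : Type := {T : Fin n → (SeqSpace →L[ℂ] SeqSpace) // IsCuntzFamily T}

/-- The C⋆-algebra of bounded families of operators indexed by all representations. -/
abbrev Ambient (n : ℕ) : Type := lp (fun _ : CuntzRep n => SeqSpace →L[ℂ] SeqSpace) ∞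

instance (n : ℕ) : CStarAlgebra (Ambient n) where

/-- The universal generators: the family `T ↦ T i`. -/
def ambientGen (n : ℕ) (i : Fin n) : Ambient n :=
  ⟨fun T => T.1 i, memℓp_infty ⟨1, by
    rintro _ ⟨T, rfl⟩
    have h := CStarRing.norm_star_mul_self (x := T.1 i)
    rw [T.2.isometry i, norm_one] at h
    nlinarith [norm_nonneg (T.1 i)]⟩⟩

/-- The closed ⋆-subalgebra generated by the universal generators. -/
def cuntzSubalgebra (n : ℕ) : StarSubalgebra ℂ (Ambient n) :=
  (StarAlgebra.adjoin ℂ (Set.range (ambientGen n))).topologicalClosure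

instance (n : ℕ) : IsClosed (cuntzSubalgebra n : Set (Ambient n)) :=
  StarSubalgebra.isClosed_topologicalClosure _

/-- The Cuntz algebra `O_n`: the universal C⋆-algebra generated by `n` isometries `S i` with
`∑ i, S i * (S i)* = 1`, realised as the norm-closed ⋆-algebra generated by the direct sum of all
representations of these relations. -/
def CuntzAlgebra (n : ℕ) : Type := cuntzSubalgebra n

instance (n : ℕ) : CStarAlgebra (CuntzAlgebra n) := inferInstanceAs (CStarAlgebra (cuntzSubalgebra n))

/-- The inclusion of `O_n` in the ambient C⋆-algebra. -/
def CuntzAlgebra.val {n : ℕ} : CuntzAlgebra n →⋆ₐ[ℂ] Ambient n := (cuntzSubalgebra n).subtype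

lemma CuntzAlgebra.norm_val {n : ℕ} (a : CuntzAlgebra n) : ‖CuntzAlgebra.val a‖ = ‖a‖ := rfl

lemma CuntzAlgebra.isometry_val {n : ℕ} : Isometry (CuntzAlgebra.val (n := n)) :=
  AddMonoidHomClass.isometry_of_norm _ CuntzAlgebra.norm_val

lemma CuntzAlgebra.ext {n : ℕ} {a b : CuntzAlgebra n} (h : CuntzAlgebra.val a = CuntzAlgebra.val b) : a = b := Subtype.ext h

instance (n : ℕ) : PartialOrder (CuntzAlgebra n) := CStarAlgebra.spectralOrder _
instance (n : ℕ) : StarOrderedRing (CuntzAlgebra n) := CStarAlgebra.spectralOrderedRing _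

/-- The generating isometries `S i` of `O_n`. -/
def gen (n : ℕ) (i : Fin n) : CuntzAlgebra n :=
  ⟨ambientGen n i, StarSubalgebra.le_topologicalClosure _
    (StarAlgebra.subset_adjoin ℂ _ ⟨i, rfl⟩)⟩

lemma val_gen (n : ℕ) (i : Fin n) : CuntzAlgebra.val (gen n i) = ambientGen n i := rfl

lemma isCuntzFamily_gen (n : ℕ) : IsCuntzFamily (gen n) where
  isometry i := by
    apply CuntzAlgebra.ext
    rw [map_mul, map_star, map_one, val_gen]
    ext1; funext T
    exact T.2.isometry i
  sum_range := by
    apply CuntzAlgebra.ext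
    simp only [map_sum, map_mul, map_star, map_one, val_gen]
    ext1; funext T
    rw [lp.coeFn_sum, Finset.sum_apply]
    exact T.2.sum_range

/-- The product `S_μ = S_{μ₁} ⋯ S_{μₖ}`, for a word `μ` of length `k`; `S_∅ = 1`. -/
def word {n : ℕ} (μ : List (Fin n)) : CuntzAlgebra n := (μ.map (gen n)).prod

/-- The dense subalgebra `O_{nc} = span {S_μ S_ν*}`. -/
def polyAlgebra (n : ℕ) : Submodule ℂ (CuntzAlgebra n) :=
  Submodule.span ℂ {a | ∃ μ ν : List (Fin n), a = word μ * star (word ν)}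

/-- The representation `z T` obtained by multiplying all the isometries by `z`. -/
def CuntzRep.rotate {n : ℕ} (z : Circle) (T : CuntzRep n) : CuntzRep n :=
  ⟨fun i => (z : ℂ) • T.1 i, by
    have hz : (z : ℂ) * (starRingEnd ℂ) (z : ℂ) = 1 := by
      rw [Complex.mul_conj, Circle.normSq_coe]; simp
    constructor
    · intro i
      simp only [star_smul, smul_mul_smul_comm, Complex.star_def, mul_comm ((starRingEnd ℂ) (z : ℂ)), hz, one_smul,
        T.2.isometry i]
    · simp only [star_smul, smul_mul_smul_comm, Complex.star_def, hz, one_smul, T.2.sum_range]⟩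

/-- The map induced by `T ↦ z T` on bounded families; it sends `S i` to `z S i`. -/
def ambientGauge {n : ℕ} (z : Circle) : Ambient n →⋆ₐ[ℂ] Ambient n where
  toFun f := ⟨fun T => f (T.rotate z), memℓp_infty ⟨‖f‖, by
    rintro _ ⟨T, rfl⟩
    exact lp.norm_apply_le_norm ENNReal.top_ne_zero f _⟩⟩
  map_one' := rfl
  map_mul' _ _ := rfl
  map_zero' := rfl
  map_add' _ _ := rfl
  commutes' _ := rfl
  map_star' _ := rfl

lemma norm_ambientGauge_le {n : ℕ} (z : Circle) (a : Ambient n) : ‖ambientGauge z a‖ ≤ ‖a‖ :=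
  lp.norm_le_of_forall_le (norm_nonneg _) fun _ =>
    lp.norm_apply_le_norm ENNReal.top_ne_zero a _

/-- `ambientGauge` as a continuous linear map. -/
def ambientGaugeL {n : ℕ} (z : Circle) : Ambient n →L[ℂ] Ambient n :=
  (ambientGauge z).toAlgHom.toLinearMap.mkContinuous 1 fun a => by
    rw [one_mul]; exact norm_ambientGauge_le z a

lemma ambientGauge_gen {n : ℕ} (z : Circle) (i : Fin n) :
    ambientGauge z (ambientGen n i) = (z : ℂ) • ambientGen n i := rfl

lemma ambientGauge_mem {n : ℕ} (z : Circle) {a : Ambient n} (ha : a ∈ cuntzSubalgebra n) :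
    ambientGauge z a ∈ cuntzSubalgebra n := by
  have h1 : StarAlgebra.adjoin ℂ (Set.range (ambientGen n)) ≤
      ((StarAlgebra.adjoin ℂ (Set.range (ambientGen n))).topologicalClosure).comap
        (ambientGauge z) := by
    rw [StarAlgebra.adjoin_le_iff]
    rintro _ ⟨i, rfl⟩
    change ambientGauge z (ambientGen n i) ∈ cuntzSubalgebra n
    rw [ambientGauge_gen]
    exact SMulMemClass.smul_mem _ (gen n i).2
  refine StarSubalgebra.topologicalClosure_minimal h1 ?_ ha
  exact (StarSubalgebra.isClosed_topologicalClosure _).preimage (ambientGaugeL z).continuous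

/-- The gauge action `σ_z` of the circle on `O_n`, determined by `σ_z (S i) = z S i`. -/
def gauge {n : ℕ} (z : Circle) : CuntzAlgebra n →⋆ₐ[ℂ] CuntzAlgebra n :=
  ((ambientGauge z).comp (cuntzSubalgebra n).subtype).codRestrict (cuntzSubalgebra n)
    fun a => ambientGauge_mem z a.2

lemma val_gauge {n : ℕ} (z : Circle) (a : CuntzAlgebra n) :
    CuntzAlgebra.val (gauge z a) = ambientGauge z (CuntzAlgebra.val a) := rfl

lemma gauge_gen {n : ℕ} (z : Circle) (i : Fin n) : gauge z (gen n i) = (z : ℂ) • gen n i := rfl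

lemma gauge_mul {n : ℕ} (z w : Circle) (a : CuntzAlgebra n) : gauge z (gauge w a) = gauge (z * w) a := by
  apply CuntzAlgebra.ext
  rw [val_gauge, val_gauge, val_gauge]
  ext1; funext T
  change (CuntzAlgebra.val a) ((T.rotate z).rotate w) = (CuntzAlgebra.val a) (T.rotate (z * w))
  have : (T.rotate z).rotate w = T.rotate (z * w) := by
    apply Subtype.ext
    funext i
    simp [CuntzRep.rotate, smul_smul, mul_comm]
  rw [this]

lemma norm_gauge_le {n : ℕ} (z : Circle) (a : CuntzAlgebra n) : ‖gauge z a‖ ≤ ‖a‖ :=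
  norm_ambientGauge_le z (CuntzAlgebra.val a)

/-- `gauge` as a continuous linear map. -/
def gaugeL {n : ℕ} (z : Circle) : CuntzAlgebra n →L[ℂ] CuntzAlgebra n :=
  (gauge z).toAlgHom.toLinearMap.mkContinuous 1 fun a => by
    rw [one_mul]; exact norm_gauge_le z a

lemma gaugeL_apply {n : ℕ} (z : Circle) (a : CuntzAlgebra n) : gaugeL z a = gauge z a := rfl

lemma continuous_gauge {n : ℕ} (a : CuntzAlgebra n) : Continuous fun z : Circle => gauge z a := by
  have hadj : ∀ b ∈ StarAlgebra.adjoin ℂ (Set.range (ambientGen n)),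
      Continuous fun z : Circle => ambientGauge z b := by
    intro b hb
    induction hb using StarAlgebra.adjoin_induction with
    | mem x hx =>
      obtain ⟨i, rfl⟩ := hx
      simp only [ambientGauge_gen]
      fun_prop
    | algebraMap r =>
      have h : ∀ z : Circle, ambientGauge z (algebraMap ℂ (Ambient n) r) =
          algebraMap ℂ (Ambient n) r := fun _ => rfl
      simp only [h]
      exact continuous_const
    | add x y _ _ hx hy => simp only [map_add]; exact hx.add hy
    | mul x y _ _ hx hy => simp only [map_mul]; exact hx.mul hy
    | star x _ hx => simp only [map_star]; exact hx.star
  rw [← CuntzAlgebra.isometry_val.comp_continuous_iff]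
  change Continuous fun z : Circle => ambientGauge z (CuntzAlgebra.val a)
  have ha : CuntzAlgebra.val a ∈ closure
      (StarAlgebra.adjoin ℂ (Set.range (ambientGen n)) : Set (Ambient n)) := a.2
  refine continuous_of_uniform_approx_of_continuous fun u hu => ?_
  obtain ⟨ε, hε, hεu⟩ := Metric.mem_uniformity_dist.1 hu
  obtain ⟨b, hb, hab⟩ := Metric.mem_closure_iff.1 ha ε hε
  refine ⟨fun z => ambientGauge z b, hadj b hb, fun z => hεu ?_⟩
  rw [dist_eq_norm] at hab ⊢
  rw [← map_sub]
  exact (norm_ambientGauge_le z _).trans_lt hab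

/-- The fixed-point algebra `F` of the gauge action. -/
def fixedAlgebra (n : ℕ) : StarSubalgebra ℂ (CuntzAlgebra n) where
  carrier := {a | ∀ z : Circle, gauge z a = a}
  mul_mem' ha hb z := by rw [map_mul, ha z, hb z]
  add_mem' ha hb z := by rw [map_add, ha z, hb z]
  algebraMap_mem' r z := AlgHomClass.commutes (gauge z) r
  star_mem' ha z := by rw [map_star, ha z]

/-- `(1 / 2π) ∫ σ_{exp(iθ)}(a) dθ` over `[0, 2π]`. -/
def average {n : ℕ} (a : CuntzAlgebra n) : CuntzAlgebra n :=
  ((2 * Real.pi)⁻¹ : ℝ) • ∫ θ in (0 : ℝ)..(2 * Real.pi), gauge (Circle.exp θ) a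

lemma continuous_gauge_exp {n : ℕ} (a : CuntzAlgebra n) :
    Continuous fun θ : ℝ => gauge (Circle.exp θ) a :=
  (continuous_gauge a).comp Circle.exp.continuous

lemma gauge_average {n : ℕ} (z : Circle) (a : CuntzAlgebra n) : gauge z (average a) = average a := by
  obtain ⟨t, rfl⟩ : ∃ t : ℝ, Circle.exp t = z := ⟨_, Circle.exp_arg z⟩
  have hper : Function.Periodic (fun θ : ℝ => gauge (Circle.exp θ) a) (2 * Real.pi) := by
    intro θ; simp only [Circle.periodic_exp θ]
  unfold average
  rw [← gaugeL_apply, ContinuousLinearMap.map_smul_of_tower, ← (gaugeL (Circle.exp t)).intervalIntegral_comp_comm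
    ((continuous_gauge_exp a).intervalIntegrable _ _)]
  congr 1
  have : ∀ θ : ℝ, gaugeL (Circle.exp t) (gauge (Circle.exp θ) a) = gauge (Circle.exp (θ + t)) a := by
    intro θ
    rw [gaugeL_apply, gauge_mul, ← Circle.exp_add, add_comm]
  simp only [this]
  rw [intervalIntegral.integral_comp_add_right (fun θ => gauge (Circle.exp θ) a) t, zero_add,
    add_comm (2 * Real.pi) t, hper.intervalIntegral_add_eq t 0, zero_add]

lemma average_nonneg {n : ℕ} {a : CuntzAlgebra n} (ha : 0 ≤ a) : 0 ≤ average a := by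
  refine smul_nonneg (by positivity) ?_
  rw [intervalIntegral.integral_of_le (by positivity)]
  refine integral_nonneg fun θ => ?_
  change 0 ≤ gauge (Circle.exp θ) a
  rw [← map_zero (gauge (Circle.exp θ))]
  exact OrderHomClass.mono (gauge (Circle.exp θ)) ha

lemma average_gauge {n : ℕ} (z : Circle) (a : CuntzAlgebra n) : average (gauge z a) = average a := by
  obtain ⟨t, rfl⟩ : ∃ t : ℝ, Circle.exp t = z := ⟨_, Circle.exp_arg z⟩
  rw [← gauge_average (Circle.exp t) a]
  unfold average
  rw [← gaugeL_apply (Circle.exp t) (((2 * Real.pi)⁻¹ : ℝ) • _),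
    ContinuousLinearMap.map_smul_of_tower, ← (gaugeL (Circle.exp t)).intervalIntegral_comp_comm
    ((continuous_gauge_exp a).intervalIntegrable _ _)]
  simp only [gaugeL_apply, gauge_mul, mul_comm]

/-- The expectation `Φ : O_n → F`, `Φ(a) = (1 / 2π) ∫ σ_{exp(iθ)}(a) dθ`. -/
def condExp (n : ℕ) : CuntzAlgebra n →ₗ[ℂ] fixedAlgebra n where
  toFun a := ⟨average a, fun z => gauge_average z a⟩
  map_add' a b := by
    ext1
    simp only [average, map_add]
    change _ = average a + average b
    rw [intervalIntegral.integral_add ((continuous_gauge_exp a).intervalIntegrable _ _)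
      ((continuous_gauge_exp b).intervalIntegrable _ _), smul_add]
    rfl
  map_smul' c a := by
    ext1
    simp only [average, map_smul]
    change _ = c • average a
    rw [intervalIntegral.integral_smul, smul_comm]
    rfl

/-- A faithful normalised trace `τ : F → ℂ`. For `n ≥ 2` there is exactly one. -/
structure FaithfulTrace (n : ℕ) extends fixedAlgebra n →ₗ[ℂ] ℂ where
  map_nonneg' : ∀ f : fixedAlgebra n, 0 ≤ (f : CuntzAlgebra n) → 0 ≤ toFun f
  map_one' : toFun 1 = 1
  map_mul_comm' : ∀ f g : fixedAlgebra n, toFun (f * g) = toFun (g * f)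
  faithful' : ∀ f : fixedAlgebra n, toFun (star f * f) = 0 → f = 0

variable {n : ℕ}

/-- The state `ψ = τ ∘ Φ` on `O_n`. -/
def kms (τ : FaithfulTrace n) : CuntzAlgebra n →ₚ[ℂ] ℂ :=
  PositiveLinearMap.mk₀ (τ.toLinearMap ∘ₗ condExp n) fun a ha =>
    τ.map_nonneg' (condExp n a) (average_nonneg ha)

/-- The GNS space `L²(O_n)` of `ψ`, with `⟪a, b⟫ = ψ (a* b)`. -/
abbrev HilbSpace (τ : FaithfulTrace n) : Type := (kms τ).GNS

/-- The vector of `L²(O_n)` given by an element of `O_n`. -/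
def toHilb (τ : FaithfulTrace n) (a : CuntzAlgebra n) : HilbSpace τ := ((kms τ).toPreGNS a : (kms τ).PreGNS)

/-- The representation `π` of `O_n` on `L²(O_n)` by left multiplication. -/
abbrev leftRep (τ : FaithfulTrace n) : CuntzAlgebra n →⋆ₐ[ℂ] (HilbSpace τ →L[ℂ] HilbSpace τ) := (kms τ).gnsStarAlgHom

lemma kms_gauge (τ : FaithfulTrace n) (z : Circle) (a : CuntzAlgebra n) : kms τ (gauge z a) = kms τ a := by
  change τ.toLinearMap (condExp n (gauge z a)) = τ.toLinearMap (condExp n a)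
  congr 1
  ext1
  exact average_gauge z a

/-- The unitary on `L²(O_n)` that extends `σ_z`. -/
def gaugeUnitary (τ : FaithfulTrace n) (z : Circle) : HilbSpace τ →L[ℂ] HilbSpace τ :=
  ContinuousLinearMap.completion <|
    ((kms τ).toPreGNS.toLinearMap ∘ₗ (gauge (n := n) z).toAlgHom.toLinearMap ∘ₗ
      (kms τ).ofPreGNS.toLinearMap).mkContinuous 1 fun x => by
        rw [one_mul]
        apply le_of_eq
        rw [PositiveLinearMap.preGNS_norm_def, PositiveLinearMap.preGNS_norm_def]
        have : star ((kms τ).ofPreGNS (((kms τ).toPreGNS.toLinearMap ∘ₗ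
            (gauge (n := n) z).toAlgHom.toLinearMap ∘ₗ (kms τ).ofPreGNS.toLinearMap) x)) *
            ((kms τ).ofPreGNS (((kms τ).toPreGNS.toLinearMap ∘ₗ
            (gauge (n := n) z).toAlgHom.toLinearMap ∘ₗ (kms τ).ofPreGNS.toLinearMap) x))
            = gauge z (star ((kms τ).ofPreGNS x) * (kms τ).ofPreGNS x) := by
          rw [map_mul, map_star]; rfl
        rw [this, kms_gauge]

lemma gaugeUnitary_toHilb (τ : FaithfulTrace n) (z : Circle) (a : CuntzAlgebra n) :
    gaugeUnitary τ z (toHilb τ a) = toHilb τ (gauge z a) := by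
  simp [gaugeUnitary, toHilb]

/-- The finite rank endomorphisms `End_F^{00}(O_{nc})`, as operators on `L²(O_n)`: the span of the
bounded extensions of `Θ_{x,y} : z ↦ x Φ(y* z)`, with `x, y ∈ O_{nc}`. -/
def finiteRank (τ : FaithfulTrace n) : Submodule ℂ (HilbSpace τ →L[ℂ] HilbSpace τ) :=
  Submodule.span ℂ {T | ∃ x ∈ polyAlgebra n, ∃ y ∈ polyAlgebra n,
    ∀ z : CuntzAlgebra n, T (toHilb τ z) = toHilb τ (x * (condExp n (star y * z) : CuntzAlgebra n))}

/-- The von Neumann algebra `s''` generated by a self-adjoint set `s` (in general, by `s ∪ s*`). -/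
def doubleCommutant {H : Type*} [NormedAddCommGroup H] [InnerProductSpace ℂ H] [CompleteSpace H]
    (s : Set (H →L[ℂ] H)) : VonNeumannAlgebra H where
  toStarSubalgebra :=
    StarSubalgebra.centralizer ℂ (StarSubalgebra.centralizer ℂ s : Set (H →L[ℂ] H))
  centralizer_centralizer' := by
    change Set.centralizer (Set.centralizer
      (StarSubalgebra.centralizer ℂ (StarSubalgebra.centralizer ℂ s : Set (H →L[ℂ] H)) :
        Set (H →L[ℂ] H))) = (StarSubalgebra.centralizer ℂ
          (StarSubalgebra.centralizer ℂ s : Set (H →L[ℂ] H)) : Set (H →L[ℂ] H))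
    rw [StarSubalgebra.coe_centralizer, Set.centralizer_centralizer_centralizer]

/-- The von Neumann algebra `N = (End_F^{00}(O_{nc}))''` on `L²(O_n)`. -/
def cuntzVN (τ : FaithfulTrace n) : VonNeumannAlgebra (HilbSpace τ) := doubleCommutant (finiteRank τ)

/-- The `k`-th spectral subspace of the circle action on `L²(O_n)`. -/
def spectralSubspace (τ : FaithfulTrace n) (k : ℤ) : Submodule ℂ (HilbSpace τ) where
  carrier := {ξ | ∀ z : Circle, gaugeUnitary τ z ξ = ((z ^ k : Circle) : ℂ) • ξ}
  add_mem' ha hb z := by rw [map_add, ha z, hb z, smul_add]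
  zero_mem' z := by rw [map_zero, smul_zero]
  smul_mem' c ξ h z := by rw [map_smul, h z, smul_comm]

/-- The orthogonal projection onto the closure of a subspace. -/
def closureProj {H : Type*} [NormedAddCommGroup H] [InnerProductSpace ℂ H] [CompleteSpace H]
    (V : Submodule ℂ H) : H →L[ℂ] H := V.topologicalClosure.starProjection

/-- The projection `Φ_k` onto the `k`-th spectral subspace. -/
def specProj (τ : FaithfulTrace n) (k : ℤ) : HilbSpace τ →L[ℂ] HilbSpace τ := closureProj (spectralSubspace τ k)

/-- The generator `D` of the unitary implementation of the gauge action, `exp(itD) = U_{exp(it)}`: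
`D ξ = -i (d/dt) U_{exp(it)} ξ` at `t = 0`, on all `ξ` for which this derivative exists. -/
def gaugeGenerator (τ : FaithfulTrace n) : HilbSpace τ →ₗ.[ℂ] HilbSpace τ where
  domain :=
    { carrier := {ξ | DifferentiableAt ℝ (fun t : ℝ => gaugeUnitary τ (Circle.exp t) ξ) 0}
      add_mem' := fun ha hb => by
        simp only [Set.mem_ofPred_eq, map_add]; exact DifferentiableAt.add ha hb
      zero_mem' := by simp
      smul_mem' := fun c ξ h => by
        simp only [Set.mem_ofPred_eq, map_smul]; exact DifferentiableAt.const_smul h c }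
  toFun :=
    { toFun := fun ξ => -Complex.I •
        deriv (fun t : ℝ => gaugeUnitary τ (Circle.exp t) (ξ : HilbSpace τ)) 0
      map_add' := fun ξ η => by
        simp only [Submodule.coe_add, map_add]
        rw [deriv_fun_add ξ.2 η.2, smul_add]
      map_smul' := fun c ξ => by
        simp only [Submodule.coe_smul, map_smul, RingHom.id_apply]
        rw [deriv_fun_const_smul c ξ.2, smul_comm] }

/-- The eigenspace `{ξ ∈ dom D | D ξ = c ξ}`. -/
def eigenspace {H : Type*} [NormedAddCommGroup H] [InnerProductSpace ℂ H]
    (D : H →ₗ.[ℂ] H) (c : ℂ) : Submodule ℂ H :=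
  D.graph.comap (LinearMap.id.prod (c • LinearMap.id))

/-- Functional calculus `g(D) = ∑ g(k) P_{ker (D - k)}` (norm convergent sum) for a self-adjoint `D`
with eigenvalues in `ℤ` and a complete system of eigenvectors, and a function `g` that tends to `0`
at infinity. -/
def funCalc {H : Type*} [NormedAddCommGroup H] [InnerProductSpace ℂ H] [CompleteSpace H]
    (D : H →ₗ.[ℂ] H) (g : ℝ → ℝ) : H →L[ℂ] H :=
  ∑' k : ℤ, (g k : ℂ) • closureProj (eigenspace D (k : ℂ))

/-- The operator `(1 + D²)^{-s/2}`. -/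
def resolventPow (τ : FaithfulTrace n) (s : ℝ) : HilbSpace τ →L[ℂ] HilbSpace τ :=
  funCalc (gaugeGenerator τ) fun x => (1 + x ^ 2) ^ (-s / 2)

/-- The graph of the closure of the conjugate-linear operator `𝒮 : a ↦ a*` on `O_{nc}`. -/
def tomitaGraph (τ : FaithfulTrace n) : Set (HilbSpace τ × HilbSpace τ) :=
  closure {p | ∃ a ∈ polyAlgebra n, p = (toHilb τ a, toHilb τ (star a))}

/-- The graph of the modular operator `Δ = ℱ 𝒮`, where `ℱ` is the (conjugate-linear) adjoint of `𝒮`: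
`η = ℱ ζ` if and only if `⟪𝒮 a, ζ⟫ = ⟪η, a⟫` for all `a ∈ O_{nc}`. -/
def modularGraph (τ : FaithfulTrace n) : Set (HilbSpace τ × HilbSpace τ) :=
  {p | ∃ ζ, (p.1, ζ) ∈ tomitaGraph τ ∧ ∀ a ∈ polyAlgebra n, ⟪toHilb τ (star a), ζ⟫_ℂ = ⟪p.2, toHilb τ a⟫_ℂ}

/-- The bounded operator `Δ_N = Δ (∑_{|k| ≤ N} Φ_k)`; it is the only `R` with
`R ξ = Δ (∑_{|k| ≤ N} Φ_k) ξ` for all `ξ`. -/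
def modularCut (τ : FaithfulTrace n) (N : ℕ) : HilbSpace τ →L[ℂ] HilbSpace τ :=
  Classical.epsilon fun R : HilbSpace τ →L[ℂ] HilbSpace τ =>
    ∀ ξ, ((∑ k ∈ Finset.Icc (-(N : ℤ)) N, specProj τ k) ξ, R ξ) ∈ modularGraph τ

/-- `⟪a, T a⟫`. -/
def vecState (τ : FaithfulTrace n) (a : CuntzAlgebra n) (T : HilbSpace τ →L[ℂ] HilbSpace τ) : ℂ :=
  ⟪toHilb τ a, T (toHilb τ a)⟫_ℂ

/-- The trace `τ̃` on `N`, as a sum of vector functionals: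
`τ̃(T) = ⟪1, T 1⟫ + ∑_{μ ≠ ∅} (⟪S_μ, T S_μ⟫ + n^{-|μ|} ⟪S_μ*, T S_μ*⟫)`. It is used on the `τ̃`-trace-class
operators `Δ_N T`, for which only finitely many terms are nonzero. -/
def tauTilde (τ : FaithfulTrace n) (T : HilbSpace τ →L[ℂ] HilbSpace τ) : ℂ :=
  vecState τ 1 T + ∑' μ : {μ : List (Fin n) // μ ≠ []},
    (vecState τ (word μ.1) T + (1 / (n : ℂ) ^ μ.1.length) * vecState τ (star (word μ.1)) T)

/-- The weight `τ_Δ(T) = lim_N τ̃(Δ_N T)`. For `T ≥ 0` in `N` the sequence is nonnegative and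
increasing, so that the limit is the supremum; for other `T` the limit extends the weight linearly to
all `T` for which it exists. -/
def tauDelta (τ : FaithfulTrace n) (T : HilbSpace τ →L[ℂ] HilbSpace τ) : ℂ :=
  limUnder atTop fun N : ℕ => tauTilde τ (modularCut τ N * T)

/-- Lebesgue measure on `(0, ∞)`. -/
abbrev halfLine : Measure ℝ := volume.restrict (Set.Ioi 0)

/-- A state `ω` on `L^∞(ℝ_+)` with `liminf g ≤ ω(g) ≤ limsup g` for real-valued `g`. As `g` is a
class modulo null sets, its (essential) lower and upper limits at infinity are those along the filter
`atTop ⊓ ae`. -/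
structure GeneralizedLimit extends Lp ℂ ∞ halfLine →ₗ[ℂ] ℂ where
  map_one' : toFun ((memLp_top_const (1 : ℂ)).toLp _) = 1
  map_nonneg' : ∀ g : Lp ℂ ∞ halfLine, (∀ᵐ t ∂halfLine, 0 ≤ g t) → 0 ≤ toFun g
  liminf_le' : ∀ (g : ℝ → ℝ) (hg : MemLp (fun t => (g t : ℂ)) ∞ halfLine),
    liminf g (atTop ⊓ ae halfLine) ≤ (toFun (hg.toLp _)).re
  le_limsup' : ∀ (g : ℝ → ℝ) (hg : MemLp (fun t => (g t : ℂ)) ∞ halfLine),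
    (toFun (hg.toLp _)).re ≤ limsup g (atTop ⊓ ae halfLine)

/-- `c` is the generalised limit `ω-lim_{t → ∞} g(t)` of a function `g` that is measurable and
essentially bounded near infinity: some element of `L^∞(ℝ_+)` agrees with `g` a.e. near infinity, and
`ω` takes the value `c` on every such element. -/
def GeneralizedLimit.HasLim (ω : GeneralizedLimit) (g : ℝ → ℂ) (c : ℂ) : Prop :=
  (∃ f : Lp ℂ ∞ halfLine, ∀ᶠ t in atTop ⊓ ae halfLine, f t = g t) ∧
    ∀ f : Lp ℂ ∞ halfLine, (∀ᶠ t in atTop ⊓ ae halfLine, f t = g t) → ω.toLinearMap f = c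

/-- The generalised limit `ω-lim_{t → ∞} g(t)`; it is the only `c` with `ω.HasLim g c`, if there is one. -/
def GeneralizedLimit.lim (ω : GeneralizedLimit) (g : ℝ → ℂ) : ℂ := Classical.epsilon (ω.HasLim g)

/-- `(s - 1) τ_Δ(T (1 + D²)^{-s/2})`. -/
def weightedZeta (τ : FaithfulTrace n) (T : HilbSpace τ →L[ℂ] HilbSpace τ) (s : ℝ) : ℂ :=
  ((s - 1 : ℝ) : ℂ) * tauDelta τ (T * resolventPow τ s)

/-- `τ̂_ω(T) = ½ ω-lim_{s → 1+} (s - 1) τ_Δ(T (1 + D²)^{-s/2})`, through `s = 1 + 1/r`, `r → ∞`. -/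
def tauHat (τ : FaithfulTrace n) (ω : GeneralizedLimit) (T : (cuntzVN τ).toStarSubalgebra) : ℂ :=
  1 / 2 * ω.lim fun r => weightedZeta τ T (1 + 1 / r)

/-- `φ` is a state on the von Neumann algebra `M`: linear, positive and unital. -/
structure IsState {H : Type*} [NormedAddCommGroup H] [InnerProductSpace ℂ H] [CompleteSpace H]
    (M : VonNeumannAlgebra H) (φ : M.toStarSubalgebra → ℂ) : Prop where
  map_add : ∀ S T, φ (S + T) = φ S + φ T
  map_smul : ∀ (c : ℂ) (T : M.toStarSubalgebra), φ (c • T) = c * φ T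
  nonneg : ∀ T : M.toStarSubalgebra, (T : H →L[ℂ] H).IsPositive → 0 ≤ φ T
  map_one : φ 1 = 1

end Cuntz

end

/-!
The weight `τ_Δ` is diagonal in the gauge degree. For `k ≥ 0` the vectors `S_μ` with `|μ| = k` lie in
the `k`-th spectral subspace, and the vectors `S_μ*` in the `-k`-th one, so on them `(1 + D²)^{-s/2}`
is the scalar `(1 + k²)^{-s/2}` (`resolventPow_apply`) and the modular operator is the scalar `n⁻ᵏ`,
respectively `nᵏ` (`inner_modularCut`). Hence, for every bounded `T`,

  `τ_Δ(T (1 + D²)^{-s/2}) = ∑_{k ∈ ℤ} (1 + k²)^{-s/2} φ_k(T)`,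

with `φ_k(T) = n⁻ᵏ ∑_{|μ| = k} ⟪S_μ, T S_μ⟫` for `k ≥ 0` and `φ_k(T) = ∑_{|μ| = -k} ⟪S_μ*, T S_μ*⟫` for
`k < 0` (`tendsto_tauTilde`). Each `φ_k` is a state, so the series converges absolutely for `s > 1`,
and after multiplication by `s - 1` it stays bounded as `s → 1`, because
`(s - 1) ∑_{k ∈ ℤ} (1 + k²)^{-s/2} → 2` by comparison with the Riemann zeta function
(`tendsto_mul_latticeZeta`). Linearity, positivity and normalisation of `τ̂_ω` are then inherited from
the `φ_k` and from the generalised limit, whose value depends only on the behaviour of a function near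
infinity (`GeneralizedLimit.apply_congr`).

On `O_n` every `φ_k` restricts to `ψ` (`levelState_leftRep`), so that there the expression is exactly
`ψ(a) (s - 1) ∑_{k ∈ ℤ} (1 + k²)^{-s/2}`. This rests on the modular property
`ψ(a c*) = n⁻ᵏ ψ(c* a)` for `c` of degree `k` (`kms_mul_star`), which follows from the values of `ψ` on
the monomials `S_μ S_ν*` (`kms_monomial`). The same property makes `∑_{|k| ≤ N} n⁻ᵏ Φ_k` a solution of
the condition that defines `Δ_N` (`modularSum_mem`); the computation of `τ_Δ` only uses this condition.

Finally `π(O_n)` lies in the von Neumann algebra because an operator that commutes with all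
`Θ_{x,1} = π(x) Φ` is determined on the vectors of `O_{nc}` by its value at the cyclic vector `1`
(`commute_leftRep`).
-/

noncomputable section
namespace Cuntz
variable {n : ℕ}

/-! ### Words in the generators -/

@[simp] lemma word_nil : (word [] : CuntzAlgebra n) = 1 := rfl

lemma word_cons (i : Fin n) (μ : List (Fin n)) : word (i :: μ) = gen n i * word μ := by
  simp [word]

lemma star_gen_mul_gen (i j : Fin n) : star (gen n i) * gen n j = if i = j then 1 else 0 := by
  classical
  have h := isCuntzFamily_gen n
  split_ifs with hij
  · rw [← hij, h.isometry]
  -- `∑ k, (S i* S k) (S i* S k)* = S i* S i = 1`, where the term `k = i` is already `1`.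
  have h1 : ∑ k, (star (gen n i) * gen n k) * star (star (gen n i) * gen n k) = 1 := by
    calc _ = star (gen n i) * (∑ k, gen n k * star (gen n k)) * gen n i := by
          simp only [Finset.mul_sum, Finset.sum_mul, star_mul, star_star, mul_assoc]
      _ = 1 := by rw [h.sum_range, mul_one, h.isometry]
  rw [← Finset.add_sum_erase _ _ (Finset.mem_univ i), h.isometry, star_one, mul_one,
    add_eq_left, Finset.sum_eq_zero_iff_of_nonneg fun _ _ => mul_star_self_nonneg _] at h1
  exact CStarRing.mul_star_self_eq_zero_iff _ |>.1
    (h1 j (Finset.mem_erase.2 ⟨fun e => hij e.symm, Finset.mem_univ j⟩))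

lemma star_word_mul_word {μ ν : List (Fin n)} (h : μ.length = ν.length) :
    star (word μ) * word ν = if μ = ν then 1 else 0 := by
  induction μ generalizing ν with
  | nil => obtain rfl := List.length_eq_zero_iff.1 h.symm; simp
  | cons i μ ih =>
    cases ν with
    | nil => simp at h
    | cons j ν =>
      rw [word_cons, word_cons, star_mul, mul_assoc, ← mul_assoc (star (gen n i)),
        star_gen_mul_gen]
      split_ifs with h1 h2 h2
      · obtain ⟨rfl, rfl⟩ := List.cons_eq_cons.1 h2
        rw [one_mul, ih rfl, if_pos rfl]
      · subst h1
        have : μ ≠ ν := fun e => h2 (by rw [e])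
        rw [one_mul, ih (by simpa using h), if_neg this]
      · exact absurd (List.cons_eq_cons.1 h2).1 h1
      · simp

lemma star_word_mul_self (μ : List (Fin n)) : star (word μ) * word μ = 1 := by
  rw [star_word_mul_word rfl, if_pos rfl]

/-- The finite set of words of length `k`. -/
def wordsOfLength (n : ℕ) : ℕ → Finset (List (Fin n))
  | 0 => {[]}
  | k + 1 => (Finset.univ ×ˢ wordsOfLength n k).map
      ⟨fun p => p.1 :: p.2, fun _ _ h => Prod.ext (List.cons_eq_cons.1 h).1 (List.cons_eq_cons.1 h).2⟩

lemma mem_wordsOfLength {k : ℕ} {μ : List (Fin n)} : μ ∈ wordsOfLength n k ↔ μ.length = k := by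
  induction k generalizing μ with
  | zero => simp [wordsOfLength]
  | succ k ih =>
    rw [wordsOfLength, Finset.mem_map]
    constructor
    · rintro ⟨p, hp, rfl⟩
      exact congrArg Nat.succ (ih.1 (Finset.mem_product.1 hp).2)
    · intro h
      cases μ with
      | nil => simp at h
      | cons i μ =>
        exact ⟨(i, μ), Finset.mem_product.2 ⟨Finset.mem_univ i, ih.2 (by simpa using h)⟩, rfl⟩

lemma sum_wordsOfLength_succ {M : Type*} [AddCommMonoid M] (k : ℕ) (f : List (Fin n) → M) :
    ∑ μ ∈ wordsOfLength n (k + 1), f μ = ∑ i, ∑ μ ∈ wordsOfLength n k, f (i :: μ) := by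
  rw [wordsOfLength, Finset.sum_map, Finset.sum_product]
  rfl

lemma card_wordsOfLength (k : ℕ) : (wordsOfLength n k).card = n ^ k := by
  induction k with
  | zero => rfl
  | succ k ih => simp [wordsOfLength, ih, pow_succ']

lemma sum_word_mul_star (k : ℕ) :
    ∑ μ ∈ wordsOfLength n k, word μ * star (word μ) = (1 : CuntzAlgebra n) := by
  induction k with
  | zero => simp [wordsOfLength]
  | succ k ih =>
    rw [sum_wordsOfLength_succ]
    calc _ = ∑ i, gen n i * (∑ μ ∈ wordsOfLength n k, word μ * star (word μ)) * star (gen n i) := by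
          simp only [Finset.mul_sum, Finset.sum_mul, word_cons, star_mul, mul_assoc]
      _ = 1 := by simp only [ih, mul_one, (isCuntzFamily_gen n).sum_range]

lemma gauge_word (z : Circle) (μ : List (Fin n)) :
    gauge z (word μ) = ((z ^ μ.length : Circle) : ℂ) • word μ := by
  induction μ with
  | nil => simp
  | cons i μ ih =>
    rw [word_cons, map_mul, ih, gauge_gen, smul_mul_smul_comm, List.length_cons, pow_succ',
      Circle.coe_mul]

/-- The monomial `S_μ S_ν*` has degree `|μ| - |ν|` for the gauge action. -/
lemma gauge_monomial (z : Circle) (μ ν : List (Fin n)) :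
    gauge z (word μ * star (word ν)) =
      ((z ^ ((μ.length : ℤ) - ν.length) : Circle) : ℂ) • (word μ * star (word ν)) := by
  rw [map_mul, map_star, gauge_word, gauge_word, star_smul, smul_mul_smul_comm]
  congr 1
  rw [zpow_sub, Circle.coe_mul, Circle.coe_inv_eq_conj, zpow_natCast, zpow_natCast]
  rfl

/-! ### The algebra spanned by the monomials -/

lemma monomial_mem (μ ν : List (Fin n)) : word μ * star (word ν) ∈ polyAlgebra n :=
  Submodule.subset_span ⟨μ, ν, rfl⟩

lemma word_mem (μ : List (Fin n)) : word μ ∈ polyAlgebra n := by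
  simpa using monomial_mem μ []

lemma one_mem_polyAlgebra : (1 : CuntzAlgebra n) ∈ polyAlgebra n := word_mem []

@[elab_as_elim]
lemma polyAlgebra_induction {p : (a : CuntzAlgebra n) → a ∈ polyAlgebra n → Prop}
    (mono : ∀ μ ν : List (Fin n), p (word μ * star (word ν)) (monomial_mem μ ν))
    (zero : p 0 (zero_mem _))
    (add : ∀ a b ha hb, p a ha → p b hb → p (a + b) (add_mem ha hb))
    (smul : ∀ (c : ℂ) a ha, p a ha → p (c • a) (Submodule.smul_mem _ c ha))
    {a : CuntzAlgebra n} (ha : a ∈ polyAlgebra n) : p a ha := by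
  refine Submodule.span_induction ?_ zero add smul ha
  rintro _ ⟨μ, ν, rfl⟩
  exact mono μ ν

lemma star_mem_polyAlgebra {a : CuntzAlgebra n} (ha : a ∈ polyAlgebra n) :
    star a ∈ polyAlgebra n := by
  induction ha using polyAlgebra_induction with
  | mono μ ν => rw [star_mul, star_star]; exact monomial_mem ν μ
  | zero => rw [star_zero]; exact zero_mem _
  | add a b _ _ ha hb => rw [star_add]; exact add_mem ha hb
  | smul c a _ ha => rw [star_smul]; exact Submodule.smul_mem _ _ ha

lemma gen_mul_mem {a : CuntzAlgebra n} (i : Fin n) (ha : a ∈ polyAlgebra n) :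
    gen n i * a ∈ polyAlgebra n := by
  induction ha using polyAlgebra_induction with
  | mono μ ν => rw [← mul_assoc, ← word_cons]; exact monomial_mem _ _
  | zero => rw [mul_zero]; exact zero_mem _
  | add a b _ _ ha hb => rw [mul_add]; exact add_mem ha hb
  | smul c a _ ha => rw [mul_smul_comm]; exact Submodule.smul_mem _ _ ha

lemma star_gen_mul_mem {a : CuntzAlgebra n} (i : Fin n) (ha : a ∈ polyAlgebra n) :
    star (gen n i) * a ∈ polyAlgebra n := by
  induction ha using polyAlgebra_induction with
  | mono μ ν =>
    cases μ with
    | nil =>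
      rw [word_nil, one_mul]
      have : star (gen n i) * star (word ν) = star (word (ν ++ [i])) := by
        rw [← star_mul]; simp [word]
      rw [this]
      exact star_mem_polyAlgebra (word_mem _)
    | cons j μ =>
      rw [word_cons, ← mul_assoc, ← mul_assoc, star_gen_mul_gen]
      split_ifs
      · rw [one_mul]; exact monomial_mem _ _
      · rw [zero_mul, zero_mul]; exact zero_mem _
  | zero => rw [mul_zero]; exact zero_mem _
  | add a b _ _ ha hb => rw [mul_add]; exact add_mem ha hb
  | smul c a _ ha => rw [mul_smul_comm]; exact Submodule.smul_mem _ _ ha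

lemma word_mul_mem {a : CuntzAlgebra n} (μ : List (Fin n)) (ha : a ∈ polyAlgebra n) :
    word μ * a ∈ polyAlgebra n := by
  induction μ with
  | nil => simpa using ha
  | cons i μ ih => rw [word_cons, mul_assoc]; exact gen_mul_mem i ih

lemma star_word_mul_mem {a : CuntzAlgebra n} (μ : List (Fin n)) (ha : a ∈ polyAlgebra n) :
    star (word μ) * a ∈ polyAlgebra n := by
  induction μ generalizing a with
  | nil => simpa using ha
  | cons i μ ih => rw [word_cons, star_mul, mul_assoc]; exact ih (star_gen_mul_mem i ha)

lemma mul_mem_polyAlgebra {a b : CuntzAlgebra n} (ha : a ∈ polyAlgebra n)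
    (hb : b ∈ polyAlgebra n) : a * b ∈ polyAlgebra n := by
  induction ha using polyAlgebra_induction with
  | mono μ ν => rw [mul_assoc]; exact word_mul_mem μ (star_word_mul_mem ν hb)
  | zero => rw [zero_mul]; exact zero_mem _
  | add a a' _ _ ha ha' => rw [add_mul]; exact add_mem ha ha'
  | smul c a _ ha => rw [smul_mul_assoc]; exact Submodule.smul_mem _ _ ha

lemma mul_word_mem {a : CuntzAlgebra n} (μ : List (Fin n)) (ha : a ∈ polyAlgebra n) :
    a * word μ ∈ polyAlgebra n := mul_mem_polyAlgebra ha (word_mem μ)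

lemma dense_polyAlgebra : Dense (polyAlgebra n : Set (CuntzAlgebra n)) := by
  have h : ∀ b ∈ StarAlgebra.adjoin ℂ (Set.range (ambientGen n)),
      ∃ c ∈ polyAlgebra n, CuntzAlgebra.val c = b := by
    intro b hb
    induction hb using StarAlgebra.adjoin_induction with
    | mem x hx =>
      obtain ⟨i, rfl⟩ := hx
      refine ⟨gen n i, ?_, rfl⟩
      simpa using gen_mul_mem i one_mem_polyAlgebra
    | algebraMap r =>
      exact ⟨r • 1, Submodule.smul_mem _ _ one_mem_polyAlgebra, by
        rw [map_smul, map_one, Algebra.algebraMap_eq_smul_one]⟩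
    | add x y _ _ hx hy =>
      obtain ⟨c, hc, rfl⟩ := hx
      obtain ⟨d, hd, rfl⟩ := hy
      exact ⟨c + d, add_mem hc hd, map_add _ _ _⟩
    | mul x y _ _ hx hy =>
      obtain ⟨c, hc, rfl⟩ := hx
      obtain ⟨d, hd, rfl⟩ := hy
      exact ⟨c * d, mul_mem_polyAlgebra hc hd, map_mul _ _ _⟩
    | star x _ hx =>
      obtain ⟨c, hc, rfl⟩ := hx
      exact ⟨star c, star_mem_polyAlgebra hc, map_star _ _⟩
  intro a
  have ha : CuntzAlgebra.val a ∈ closure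
      (StarAlgebra.adjoin ℂ (Set.range (ambientGen n)) : Set (Ambient n)) := a.2
  rw [Metric.mem_closure_iff] at ha ⊢
  intro ε hε
  obtain ⟨b, hb, hab⟩ := ha ε hε
  obtain ⟨c, hc, rfl⟩ := h b hb
  exact ⟨c, hc, by rwa [CuntzAlgebra.isometry_val.dist_eq] at hab⟩

/-! ### Values of the state `ψ` and its modular property -/

lemma average_of_mem {a : CuntzAlgebra n} (ha : a ∈ fixedAlgebra n) : average a = a := by
  have h : ∀ z : Circle, gauge z a = a := ha
  simp only [average, h, intervalIntegral.integral_const, sub_zero, smul_smul]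
  rw [inv_mul_cancel₀ (by positivity), one_smul]

lemma kms_apply (τ : FaithfulTrace n) (a : CuntzAlgebra n) :
    kms τ a = τ.toLinearMap (condExp n a) := rfl

lemma kms_of_mem (τ : FaithfulTrace n) (f : fixedAlgebra n) :
    kms τ f = τ.toLinearMap f := by
  rw [kms_apply]
  congr 1
  exact Subtype.ext (average_of_mem f.2)

lemma kms_one (τ : FaithfulTrace n) : kms τ 1 = 1 :=
  (kms_of_mem τ 1).trans τ.map_one'

lemma kms_star (τ : FaithfulTrace n) (a : CuntzAlgebra n) :
    kms τ (star a) = star (kms τ a) := map_star (kms τ) a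

lemma monomial_mem_fixedAlgebra {μ ν : List (Fin n)} (h : μ.length = ν.length) :
    word μ * star (word ν) ∈ fixedAlgebra n := fun z => by
  rw [gauge_monomial, h, sub_self, zpow_zero, Circle.coe_one, one_smul]

lemma kms_mul_comm_of_mem (τ : FaithfulTrace n) {a b : CuntzAlgebra n} (ha : a ∈ fixedAlgebra n)
    (hb : b ∈ fixedAlgebra n) : kms τ (a * b) = kms τ (b * a) := by
  have h : ∀ f g : fixedAlgebra n, kms τ (f * g : fixedAlgebra n) = kms τ (g * f : fixedAlgebra n) :=
    fun f g => by
      rw [kms_of_mem, kms_of_mem]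
      exact τ.map_mul_comm' f g
  exact h ⟨a, ha⟩ ⟨b, hb⟩

lemma exists_circle_zpow_ne_one {k : ℤ} (hk : k ≠ 0) : ∃ z : Circle, ((z ^ k : Circle) : ℂ) ≠ 1 := by
  refine ⟨Circle.exp (Real.pi / k), ?_⟩
  rw [← Circle.exp_zsmul, zsmul_eq_mul, mul_div_cancel₀ _ (by exact_mod_cast hk),
    Circle.coe_exp, Complex.exp_pi_mul_I]
  norm_num

/-- The state `ψ` on monomials: different degrees are killed by gauge invariance, and the trace
property identifies the range projections of the words of a given length, whose sum is `1`. -/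
lemma kms_monomial [NeZero n] (τ : FaithfulTrace n) (μ ν : List (Fin n)) :
    kms τ (word μ * star (word ν)) = if μ = ν then ((n : ℂ) ^ μ.length)⁻¹ else 0 := by
  by_cases hl : μ.length = ν.length
  · have hflip : ∀ α β : List (Fin n), α.length = β.length →
        kms τ (word α * star (word β)) =
          kms τ ((word β * star (word β)) * (word α * star (word β))) := fun α β h => by
      rw [kms_mul_comm_of_mem τ (monomial_mem_fixedAlgebra rfl) (monomial_mem_fixedAlgebra h),
        mul_assoc, ← mul_assoc (star (word β)), star_word_mul_self, one_mul]
    have hdiag : ∀ α ∈ wordsOfLength n μ.length,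
        kms τ (word α * star (word α)) = kms τ (word μ * star (word μ)) := fun α hα => by
      rw [mem_wordsOfLength] at hα
      have h1 : word α * star (word α) = (word α * star (word μ)) * (word μ * star (word α)) := by
        rw [mul_assoc, ← mul_assoc (star (word μ)), star_word_mul_self, one_mul]
      have h2 : word μ * star (word μ) = (word μ * star (word α)) * (word α * star (word μ)) := by
        rw [mul_assoc, ← mul_assoc (star (word α)), star_word_mul_self, one_mul]
      rw [h1, h2, kms_mul_comm_of_mem τ (monomial_mem_fixedAlgebra hα)
        (monomial_mem_fixedAlgebra hα.symm)]
    split_ifs with h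
    · subst h
      have h3 := congrArg (kms τ) (sum_word_mul_star (n := n) μ.length)
      rw [map_sum, Finset.sum_congr rfl hdiag, Finset.sum_const, card_wordsOfLength, kms_one,
        nsmul_eq_mul, Nat.cast_pow] at h3
      exact eq_inv_of_mul_eq_one_right h3
    · rw [hflip μ ν hl, mul_assoc, ← mul_assoc (star (word ν)), star_word_mul_word hl.symm,
        if_neg (Ne.symm h), zero_mul, mul_zero, map_zero]
  · rw [if_neg fun h => hl (by rw [h])]
    obtain ⟨z, hz⟩ := exists_circle_zpow_ne_one (k := (μ.length : ℤ) - ν.length) (by omega)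
    have h := kms_gauge τ z (word μ * star (word ν))
    rw [gauge_monomial, map_smul, smul_eq_mul] at h
    by_contra h0
    exact hz (mul_right_cancel₀ h0 (h.trans (one_mul _).symm))

lemma kms_gen_mul [NeZero n] (τ : FaithfulTrace n) (i : Fin n) {b : CuntzAlgebra n}
    (hb : b ∈ polyAlgebra n) : kms τ (gen n i * b) = (n : ℂ)⁻¹ * kms τ (b * gen n i) := by
  induction hb using polyAlgebra_induction with
  | mono α β =>
    rw [← mul_assoc, ← word_cons, kms_monomial, mul_assoc (word α)]
    cases β with
    | nil =>
      have : word α * (star (word []) * gen n i) = word (α ++ [i]) * star (word []) := by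
        simp [word]
      rw [this, kms_monomial]
      simp
    | cons j β =>
      rw [word_cons, star_mul, mul_assoc, star_gen_mul_gen]
      by_cases hij : j = i
      · subst hij
        rw [if_pos rfl, mul_one, kms_monomial]
        by_cases h : α = β
        · rw [if_pos (by rw [h]), if_pos h, List.length_cons, pow_succ', mul_inv]
        · rw [if_neg (by simpa using h), if_neg h, mul_zero]
      · rw [if_neg hij, mul_zero, mul_zero, map_zero, mul_zero,
          if_neg fun h => hij (List.cons_eq_cons.1 h).1.symm]
  | zero => simp
  | add a b _ _ ha hb => rw [mul_add, add_mul, map_add, map_add, ha, hb, mul_add]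
  | smul c a _ ha =>
    rw [mul_smul_comm, smul_mul_assoc, map_smul, map_smul, ha, smul_eq_mul, smul_eq_mul,
      mul_left_comm]

lemma kms_word_mul [NeZero n] (τ : FaithfulTrace n) (μ : List (Fin n)) {b : CuntzAlgebra n}
    (hb : b ∈ polyAlgebra n) :
    kms τ (word μ * b) = ((n : ℂ) ^ μ.length)⁻¹ * kms τ (b * word μ) := by
  induction μ generalizing b with
  | nil => simp
  | cons i μ ih =>
    have hi : b * gen n i ∈ polyAlgebra n := by
      simpa [word] using mul_word_mem [i] hb
    rw [word_cons, mul_assoc, kms_gen_mul τ i (word_mul_mem μ hb), mul_assoc, ih hi,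
      List.length_cons, pow_succ', mul_inv, mul_assoc, mul_assoc]

lemma kms_mul_star_word [NeZero n] (τ : FaithfulTrace n) (μ : List (Fin n)) {b : CuntzAlgebra n}
    (hb : b ∈ polyAlgebra n) :
    kms τ (b * star (word μ)) = ((n : ℂ) ^ μ.length)⁻¹ * kms τ (star (word μ) * b) := by
  have h := congrArg star (kms_word_mul τ μ (star_mem_polyAlgebra hb))
  rw [← kms_star, star_mul, star_star, star_mul, ← kms_star, star_mul, star_star] at h
  rw [h, mul_comm]
  simp

/-- The span of the monomials of degree `k`. -/
def gradedPoly (n : ℕ) (k : ℤ) : Submodule ℂ (CuntzAlgebra n) :=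
  Submodule.span ℂ {a | ∃ μ ν : List (Fin n),
    (μ.length : ℤ) - ν.length = k ∧ a = word μ * star (word ν)}

lemma monomial_mem_gradedPoly (μ ν : List (Fin n)) :
    word μ * star (word ν) ∈ gradedPoly n ((μ.length : ℤ) - ν.length) :=
  Submodule.subset_span ⟨μ, ν, rfl, rfl⟩

lemma gradedPoly_le (k : ℤ) : gradedPoly n k ≤ polyAlgebra n :=
  Submodule.span_mono fun _ ⟨μ, ν, _, h⟩ => ⟨μ, ν, h⟩

lemma gauge_of_mem_gradedPoly {k : ℤ} {a : CuntzAlgebra n} (ha : a ∈ gradedPoly n k) (z : Circle) :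
    gauge z a = ((z ^ k : Circle) : ℂ) • a := by
  induction ha using Submodule.span_induction with
  | mem a h =>
    obtain ⟨μ, ν, rfl, rfl⟩ := h
    exact gauge_monomial z μ ν
  | zero => rw [map_zero, smul_zero]
  | add a b _ _ ha hb => rw [map_add, ha, hb, smul_add]
  | smul c a _ ha => rw [map_smul, ha, smul_comm]

/-- The modular property of `ψ`: the modular operator is `n⁻ᵏ` in degree `k`. -/
lemma kms_mul_star [NeZero n] (τ : FaithfulTrace n) {k : ℤ} {a c : CuntzAlgebra n}
    (ha : a ∈ polyAlgebra n) (hc : c ∈ gradedPoly n k) :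
    kms τ (a * star c) = (n : ℂ) ^ (-k) * kms τ (star c * a) := by
  have hn : (n : ℂ) ≠ 0 := NeZero.ne _
  induction hc using Submodule.span_induction with
  | mem c h =>
    obtain ⟨μ, ν, rfl, rfl⟩ := h
    rw [star_mul, star_star, ← mul_assoc, kms_mul_star_word τ μ (mul_word_mem ν ha), mul_assoc,
      kms_word_mul τ ν (star_word_mul_mem μ ha), ← mul_assoc (star (word μ)), ← mul_assoc]
    congr 1
    rw [neg_sub, zpow_sub₀ hn, zpow_natCast, zpow_natCast]
    field_simp
  | zero => simp
  | add a b _ _ ha hb => rw [star_add, mul_add, add_mul, map_add, map_add, ha, hb, mul_add]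
  | smul c a _ ha =>
    rw [star_smul, mul_smul_comm, smul_mul_assoc, map_smul, map_smul, ha, smul_eq_mul,
      smul_eq_mul, mul_left_comm]

/-! ### The GNS space -/

section GNS
variable (τ : FaithfulTrace n)

lemma inner_toHilb (a b : CuntzAlgebra n) : ⟪toHilb τ a, toHilb τ b⟫_ℂ = kms τ (star a * b) := by
  rw [toHilb, toHilb, UniformSpace.Completion.inner_coe, PositiveLinearMap.preGNS_inner_def]
  rfl

lemma leftRep_toHilb (a b : CuntzAlgebra n) : leftRep τ a (toHilb τ b) = toHilb τ (a * b) := by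
  exact PositiveLinearMap.gnsNonUnitalStarAlgHom_apply_coe (kms τ)

lemma toHilb_eq_leftRep (a : CuntzAlgebra n) : toHilb τ a = leftRep τ a (toHilb τ 1) := by
  rw [leftRep_toHilb, mul_one]

lemma norm_leftRep_le (a : CuntzAlgebra n) : ‖leftRep τ a‖ ≤ ‖a‖ :=
  NonUnitalStarAlgHom.norm_apply_le (leftRep τ) a

lemma norm_toHilb_sq (a : CuntzAlgebra n) : ‖toHilb τ a‖ ^ 2 = (kms τ (star a * a)).re := by
  rw [← inner_toHilb, inner_self_eq_norm_sq_to_K]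
  norm_cast

lemma norm_toHilb_one : ‖toHilb τ 1‖ = 1 := by
  have h := norm_toHilb_sq τ 1
  rw [star_one, one_mul, kms_one, Complex.one_re] at h
  nlinarith [norm_nonneg (toHilb τ 1)]

/-- The map `a ↦ toHilb τ a` as a continuous linear map. -/
def toHilbL : CuntzAlgebra n →L[ℂ] HilbSpace τ :=
  LinearMap.mkContinuous
    { toFun := toHilb τ
      map_add' := fun a b => by
        rw [toHilb_eq_leftRep, map_add, add_apply, ← toHilb_eq_leftRep,
          ← toHilb_eq_leftRep]
      map_smul' := fun c a => by
        rw [toHilb_eq_leftRep, map_smul, smul_apply, ← toHilb_eq_leftRep]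
        rfl } 1 fun a => by
    rw [one_mul]
    change ‖toHilb τ a‖ ≤ ‖a‖
    rw [toHilb_eq_leftRep]
    refine (ContinuousLinearMap.le_opNorm _ _).trans ?_
    rw [norm_toHilb_one, mul_one]
    exact norm_leftRep_le τ a

lemma toHilbL_apply (a : CuntzAlgebra n) : toHilbL τ a = toHilb τ a := rfl

lemma toHilb_add (a b : CuntzAlgebra n) : toHilb τ (a + b) = toHilb τ a + toHilb τ b :=
  map_add (toHilbL τ) a b

lemma toHilb_sub (a b : CuntzAlgebra n) : toHilb τ (a - b) = toHilb τ a - toHilb τ b :=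
  map_sub (toHilbL τ) a b

lemma toHilb_smul (c : ℂ) (a : CuntzAlgebra n) : toHilb τ (c • a) = c • toHilb τ a :=
  map_smul (toHilbL τ) c a

lemma toHilb_zero : toHilb τ 0 = 0 := map_zero (toHilbL τ)

lemma toHilb_sum {ι : Type*} (s : Finset ι) (f : ι → CuntzAlgebra n) :
    toHilb τ (∑ i ∈ s, f i) = ∑ i ∈ s, toHilb τ (f i) :=
  map_sum (toHilbL τ) f s

lemma denseRange_toHilb : DenseRange (toHilb τ) := by
  have h := UniformSpace.Completion.denseRange_coe (α := (kms τ).PreGNS)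
  exact h.comp (f := fun a : CuntzAlgebra n => (kms τ).toPreGNS a)
    (kms τ).toPreGNS.surjective.denseRange (UniformSpace.Completion.continuous_coe _)

lemma dense_toHilb_polyAlgebra : Dense (toHilb τ '' (polyAlgebra n : Set (CuntzAlgebra n))) :=
  (denseRange_toHilb τ).dense_image (toHilbL τ).continuous dense_polyAlgebra

lemma inner_gaugeUnitary (z : Circle) (ξ η : HilbSpace τ) :
    ⟪gaugeUnitary τ z ξ, gaugeUnitary τ z η⟫_ℂ = ⟪ξ, η⟫_ℂ := by
  refine (denseRange_toHilb τ).induction_on₂ (isClosed_eq (by fun_prop) (by fun_prop)) ?_ ξ η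
  intro a b
  rw [gaugeUnitary_toHilb, gaugeUnitary_toHilb, inner_toHilb, inner_toHilb, ← map_star, ← map_mul,
    kms_gauge]

lemma gauge_one (a : CuntzAlgebra n) : gauge (1 : Circle) a = a := by
  apply CuntzAlgebra.ext
  rw [val_gauge]
  ext1; funext T
  change (CuntzAlgebra.val a) (T.rotate 1) = (CuntzAlgebra.val a) T
  have : T.rotate 1 = T := Subtype.ext (funext fun i => by simp [CuntzRep.rotate])
  rw [this]

lemma gaugeUnitary_one (ξ : HilbSpace τ) : gaugeUnitary τ 1 ξ = ξ := by
  refine (denseRange_toHilb τ).induction_on ξ (isClosed_eq (by fun_prop) (by fun_prop)) ?_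
  intro a
  rw [gaugeUnitary_toHilb, gauge_one]

end GNS

/-! ### Spectral subspaces and the functional calculus of the generator -/

section ClosureProj
variable {H : Type*} [NormedAddCommGroup H] [InnerProductSpace ℂ H] [CompleteSpace H]

lemma closureProj_of_mem {V : Submodule ℂ H} {ξ : H} (h : ξ ∈ V) : closureProj V ξ = ξ :=
  Submodule.starProjection_eq_self_iff.2 (V.le_topologicalClosure h)

lemma closureProj_of_orthogonal {V : Submodule ℂ H} {ξ : H} (h : ∀ η ∈ V, ⟪η, ξ⟫_ℂ = 0) :
    closureProj V ξ = 0 := by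
  rw [closureProj, Submodule.starProjection_apply_eq_zero_iff, Submodule.orthogonal_closure]
  exact (Submodule.mem_orthogonal V ξ).2 h

lemma inner_closureProj (V : Submodule ℂ H) (ξ η : H) :
    ⟪closureProj V ξ, η⟫_ℂ = ⟪ξ, closureProj V η⟫_ℂ :=
  Submodule.inner_starProjection_left_eq_right _ _ _

lemma norm_closureProj_le (V : Submodule ℂ H) : ‖closureProj V‖ ≤ 1 :=
  Submodule.starProjection_norm_le _

end ClosureProj

section Spectral
variable {τ : FaithfulTrace n}

lemma toHilb_mem_spectralSubspace {k : ℤ} {a : CuntzAlgebra n} (ha : a ∈ gradedPoly n k) :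
    toHilb τ a ∈ spectralSubspace τ k := fun z => by
  rw [gaugeUnitary_toHilb, gauge_of_mem_gradedPoly ha, toHilb_smul]

lemma inner_spectralSubspace {j k : ℤ} (hjk : j ≠ k) {ξ η : HilbSpace τ}
    (hξ : ξ ∈ spectralSubspace τ j) (hη : η ∈ spectralSubspace τ k) : ⟪ξ, η⟫_ℂ = 0 := by
  obtain ⟨z, hz⟩ := exists_circle_zpow_ne_one (sub_ne_zero.2 hjk.symm)
  have h := inner_gaugeUnitary τ z ξ η
  rw [hξ z, hη z, inner_smul_left, inner_smul_right, ← mul_assoc, ← Circle.coe_inv_eq_conj,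
    ← Circle.coe_mul, ← zpow_neg, ← zpow_add, neg_add_eq_sub] at h
  by_contra h0
  exact hz (mul_right_cancel₀ h0 (h.trans (one_mul _).symm))

lemma specProj_of_mem {k : ℤ} {ξ : HilbSpace τ} (h : ξ ∈ spectralSubspace τ k) :
    specProj τ k ξ = ξ := closureProj_of_mem h

lemma specProj_of_mem_ne {j k : ℤ} (hjk : j ≠ k) {ξ : HilbSpace τ}
    (h : ξ ∈ spectralSubspace τ j) : specProj τ k ξ = 0 :=
  closureProj_of_orthogonal fun _ hη => inner_spectralSubspace hjk.symm hη h

/-- Each spectral projection maps `O_{nc}` to homogeneous elements of `O_{nc}`. -/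
lemma exists_specProj_toHilb {b : CuntzAlgebra n} (hb : b ∈ polyAlgebra n) (k : ℤ) :
    ∃ c ∈ gradedPoly n k, specProj τ k (toHilb τ b) = toHilb τ c := by
  induction hb using polyAlgebra_induction with
  | mono μ ν =>
    have h := monomial_mem_gradedPoly μ ν
    by_cases hk : (μ.length : ℤ) - ν.length = k
    · exact ⟨_, hk ▸ h, specProj_of_mem (hk ▸ toHilb_mem_spectralSubspace h)⟩
    · refine ⟨0, zero_mem _, ?_⟩
      rw [specProj_of_mem_ne hk (toHilb_mem_spectralSubspace h), toHilb_zero]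
  | zero => exact ⟨0, zero_mem _, by rw [toHilb_zero, map_zero]⟩
  | add a b _ _ ha hb =>
    obtain ⟨c, hc, hc'⟩ := ha
    obtain ⟨d, hd, hd'⟩ := hb
    exact ⟨c + d, add_mem hc hd, by rw [toHilb_add, map_add, hc', hd', toHilb_add]⟩
  | smul r a _ ha =>
    obtain ⟨c, hc, hc'⟩ := ha
    exact ⟨r • c, Submodule.smul_mem _ _ hc, by rw [toHilb_smul, map_smul, hc', toHilb_smul]⟩

lemma mem_eigenspace_iff {k : ℂ} {ξ : HilbSpace τ} :
    ξ ∈ eigenspace (gaugeGenerator τ) k ↔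
      HasDerivAt (fun t : ℝ => gaugeUnitary τ (Circle.exp t) ξ) ((Complex.I * k) • ξ) 0 := by
  have hmem : ξ ∈ eigenspace (gaugeGenerator τ) k ↔ (ξ, k • ξ) ∈ (gaugeGenerator τ).graph :=
    Iff.rfl
  rw [hmem, LinearPMap.mem_graph_iff]
  constructor
  · rintro ⟨⟨η, hη⟩, rfl, h⟩
    change -Complex.I • deriv (fun t : ℝ => gaugeUnitary τ (Circle.exp t) η) 0 = k • η at h
    have h1 : HasDerivAt (fun t : ℝ => gaugeUnitary τ (Circle.exp t) η) _ 0 :=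
      DifferentiableAt.hasDerivAt hη
    convert h1 using 1
    rw [mul_smul]
    change Complex.I • (k • η) = _
    rw [← h, smul_smul]
    simp
  · intro h
    refine ⟨⟨ξ, h.differentiableAt⟩, rfl, ?_⟩
    change -Complex.I • deriv (fun t : ℝ => gaugeUnitary τ (Circle.exp t) ξ) 0 = k • ξ
    rw [h.deriv, smul_smul, ← mul_assoc]
    simp

lemma mem_eigenspace_of_mem {k : ℤ} {ξ : HilbSpace τ} (h : ξ ∈ spectralSubspace τ k) :
    ξ ∈ eigenspace (gaugeGenerator τ) (k : ℂ) := by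
  rw [mem_eigenspace_iff]
  have h1 : (fun t : ℝ => gaugeUnitary τ (Circle.exp t) ξ) =
      fun t : ℝ => Complex.exp (t * (Complex.I * k)) • ξ := by
    funext t
    rw [h (Circle.exp t), ← Circle.exp_zsmul, Circle.coe_exp, zsmul_eq_mul]
    congr 2
    push_cast
    ring
  rw [h1]
  have h2 : HasDerivAt (fun t : ℝ => (t : ℂ) * (Complex.I * k)) (Complex.I * k) 0 := by
    simpa using (Complex.ofRealCLM.hasDerivAt (x := (0 : ℝ))).mul_const (Complex.I * (k : ℂ))
  have h3 := h2.cexp.smul_const ξ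
  simpa using h3

lemma inner_eigenspace {j k : ℤ} (hjk : j ≠ k) {ξ η : HilbSpace τ}
    (hξ : ξ ∈ eigenspace (gaugeGenerator τ) (j : ℂ))
    (hη : η ∈ eigenspace (gaugeGenerator τ) (k : ℂ)) : ⟪ξ, η⟫_ℂ = 0 := by
  rw [mem_eigenspace_iff] at hξ hη
  -- The function `t ↦ ⟪U_t ξ, U_t η⟫` is constant with derivative `i (k - j) ⟪ξ, η⟫` at `0`.
  have h := hξ.inner ℂ hη
  simp only [inner_gaugeUnitary, Circle.exp_zero] at h
  rw [gaugeUnitary_one, gaugeUnitary_one, inner_smul_left, inner_smul_right, ← add_mul] at h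
  have h5 := h.unique (hasDerivAt_const (0 : ℝ) ⟪ξ, η⟫_ℂ)
  refine (mul_eq_zero.1 h5).resolve_left fun h6 => hjk ?_
  rw [map_mul, Complex.conj_I, map_intCast] at h6
  have h7 : Complex.I * ((k : ℂ) - j) = 0 := by linear_combination h6
  have h8 := (mul_eq_zero.1 h7).resolve_left Complex.I_ne_zero
  exact_mod_cast (sub_eq_zero.1 h8).symm

end Spectral

/-! ### The operators `(1 + D²)^{-s/2}` -/

lemma summable_weight {s : ℝ} (hs : 1 < s) :
    Summable fun k : ℕ => (1 + (k : ℝ) ^ 2) ^ (-s / 2) := by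
  have h := (summable_nat_add_iff 1).2 (Real.summable_nat_rpow.2 (show -s < -1 by linarith))
  refine (summable_nat_add_iff 1).1 (Summable.of_nonneg_of_le (fun k => by positivity)
    (fun k => ?_) h)
  calc (1 + ((k + 1 : ℕ) : ℝ) ^ 2) ^ (-s / 2) ≤ (((k + 1 : ℕ) : ℝ) ^ 2) ^ (-s / 2) :=
        Real.rpow_le_rpow_of_nonpos (by positivity) (by linarith) (by linarith)
    _ = ((k + 1 : ℕ) : ℝ) ^ (-s) := by
        rw [← Real.rpow_natCast, ← Real.rpow_mul (by positivity)]
        congr 1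
        push_cast
        ring

lemma summable_int_weight {s : ℝ} (hs : 1 < s) :
    Summable fun k : ℤ => (1 + (k : ℝ) ^ 2) ^ (-s / 2) := by
  refine Summable.of_nat_of_neg ?_ ?_ <;> simpa using summable_weight hs

lemma resolventPow_apply {τ : FaithfulTrace n} {s : ℝ} (hs : 1 < s) {j : ℤ} {ξ : HilbSpace τ}
    (hξ : ξ ∈ spectralSubspace τ j) :
    resolventPow τ s ξ = (((1 + (j : ℝ) ^ 2) ^ (-s / 2) : ℝ) : ℂ) • ξ := by
  have hsum : Summable fun k : ℤ => (((1 + (k : ℝ) ^ 2) ^ (-s / 2) : ℝ) : ℂ) •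
      closureProj (eigenspace (gaugeGenerator τ) (k : ℂ)) := by
    refine Summable.of_norm_bounded (summable_int_weight hs) fun k => ?_
    rw [norm_smul, Complex.norm_real, Real.norm_of_nonneg (by positivity)]
    exact mul_le_of_le_one_right (by positivity) (norm_closureProj_le _)
  have h := hsum.hasSum.mapL (ContinuousLinearMap.apply ℂ (HilbSpace τ) ξ)
  refine h.unique ?_
  have hj := mem_eigenspace_of_mem hξ
  have h1 := hasSum_single (f := fun k : ℤ => ContinuousLinearMap.apply ℂ (HilbSpace τ) ξ
    ((((1 + (k : ℝ) ^ 2) ^ (-s / 2) : ℝ) : ℂ) •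
      closureProj (eigenspace (gaugeGenerator τ) (k : ℂ)))) j fun k hk => by
    rw [ContinuousLinearMap.apply_apply, smul_apply,
      closureProj_of_orthogonal fun η hη => inner_eigenspace hk hη hj, smul_zero]
  rwa [ContinuousLinearMap.apply_apply, smul_apply,
    closureProj_of_mem hj] at h1
/-! ### The algebra `O_n` inside the von Neumann algebra -/

section Commutant
variable {τ : FaithfulTrace n}

lemma norm_average_le (a : CuntzAlgebra n) : ‖average a‖ ≤ ‖a‖ := by
  have h := intervalIntegral.norm_integral_le_of_norm_le_const (a := 0) (b := 2 * Real.pi)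
    (f := fun θ : ℝ => gauge (Circle.exp θ) a) fun θ _ => norm_gauge_le (Circle.exp θ) a
  have hpi : 0 < 2 * Real.pi := by positivity
  rw [sub_zero, abs_of_pos hpi] at h
  rw [average, norm_smul, Real.norm_of_nonneg (by positivity)]
  calc (2 * Real.pi)⁻¹ * _ ≤ (2 * Real.pi)⁻¹ * (‖a‖ * (2 * Real.pi)) := by gcongr
    _ = ‖a‖ := by field_simp

/-- The expectation `Φ` as a continuous linear map of `O_n`. -/
def averageL : CuntzAlgebra n →L[ℂ] CuntzAlgebra n :=
  ((fixedAlgebra n).subtype.toAlgHom.toLinearMap ∘ₗ condExp n).mkContinuous 1 fun a => by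
    rw [one_mul]; exact norm_average_le a

lemma averageL_apply (a : CuntzAlgebra n) : averageL a = average a := rfl

/-- On `L²(O_n)`, the expectation `Φ` is the projection onto the spectral subspace of degree `0`. -/
lemma specProj_zero_toHilb (z : CuntzAlgebra n) :
    specProj τ 0 (toHilb τ z) = toHilb τ (average z) := by
  refine dense_polyAlgebra.induction
    (P := fun z : CuntzAlgebra n => specProj τ 0 (toHilbL τ z) = toHilbL τ (averageL z)) ?_
    (isClosed_eq (by fun_prop) (by fun_prop)) z
  intro a ha
  induction ha using polyAlgebra_induction with
  | mono μ ν =>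
    have hm := toHilb_mem_spectralSubspace (τ := τ) (monomial_mem_gradedPoly μ ν)
    rw [toHilbL_apply, toHilbL_apply]
    by_cases h : (μ.length : ℤ) - ν.length = 0
    · rw [specProj_of_mem (h ▸ hm), averageL_apply,
        average_of_mem (monomial_mem_fixedAlgebra (by omega))]
    · obtain ⟨z, hz⟩ := exists_circle_zpow_ne_one h
      have h1 := average_gauge z (word μ * star (word ν))
      rw [gauge_monomial, ← averageL_apply, ← averageL_apply, map_smul, ← sub_eq_zero] at h1
      have h2 : averageL (word μ * star (word ν)) = 0 := by
        refine (smul_eq_zero.1 ?_).resolve_left (sub_ne_zero.2 hz)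
        rw [sub_smul, one_smul, h1]
      rw [specProj_of_mem_ne h hm, h2, toHilb_zero]
  | zero => simp
  | add a b _ _ ha hb => simp only [map_add, ha, hb]
  | smul c a _ ha => simp only [map_smul, ha]

lemma leftRep_mul_specProj_mem {x : CuntzAlgebra n} (hx : x ∈ polyAlgebra n) :
    leftRep τ x * specProj τ 0 ∈ finiteRank τ := by
  refine Submodule.subset_span ⟨x, hx, 1, one_mem_polyAlgebra, fun z => ?_⟩
  rw [mul_apply_eq_comp, specProj_zero_toHilb, leftRep_toHilb, star_one, one_mul]
  rfl

/-- An operator that commutes with `Θ_{x,1} = π(x) Φ` for all `x ∈ O_{nc}` commutes with `π(O_n)`,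
since the vector `1` is cyclic and fixed by `Φ`. -/
lemma commute_leftRep {T : HilbSpace τ →L[ℂ] HilbSpace τ}
    (hT : ∀ R ∈ finiteRank τ, R * T = T * R) (a : CuntzAlgebra n) :
    T * leftRep τ a = leftRep τ a * T := by
  have h1 : specProj τ 0 (toHilb τ 1) = toHilb τ 1 := by
    rw [specProj_zero_toHilb, average_of_mem (one_mem _)]
  have h2 : T (toHilb τ 1) = specProj τ 0 (T (toHilb τ 1)) := by
    have h := hT _ (leftRep_mul_specProj_mem one_mem_polyAlgebra)
    rw [map_one, one_mul] at h
    have := congrArg (fun R : HilbSpace τ →L[ℂ] HilbSpace τ => R (toHilb τ 1)) h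
    simp only [mul_apply_eq_comp, h1] at this
    exact this.symm
  have h3 : ∀ x ∈ polyAlgebra n, T (toHilb τ x) = leftRep τ x (T (toHilb τ 1)) := fun x hx => by
    have := congrArg (fun R : HilbSpace τ →L[ℂ] HilbSpace τ => R (toHilb τ 1))
      (hT _ (leftRep_mul_specProj_mem hx))
    simp only [mul_apply_eq_comp, h1, ← h2] at this
    rw [this, leftRep_toHilb, mul_one]
  have h4 : ∀ x : CuntzAlgebra n, T (toHilb τ x) = leftRep τ x (T (toHilb τ 1)) :=
    dense_polyAlgebra.induction
      (P := fun x : CuntzAlgebra n => T (toHilb τ x) = leftRep τ x (T (toHilb τ 1))) h3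
      (isClosed_eq (T.continuous.comp (toHilbL τ).continuous)
        ((map_continuous (leftRep τ)).clm_apply continuous_const))
  ext ξ
  refine (denseRange_toHilb τ).induction_on ξ (isClosed_eq (by fun_prop) (by fun_prop)) fun x => ?_
  rw [mul_apply_eq_comp, mul_apply_eq_comp, leftRep_toHilb, h4, h4 x,
    map_mul, mul_apply_eq_comp]

lemma leftRep_mem_cuntzVN (a : CuntzAlgebra n) :
    leftRep τ a ∈ (cuntzVN τ).toStarSubalgebra := by
  change leftRep τ a ∈ StarSubalgebra.centralizer ℂ (StarSubalgebra.centralizer ℂ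
    (finiteRank τ : Set (HilbSpace τ →L[ℂ] HilbSpace τ)) : Set (HilbSpace τ →L[ℂ] HilbSpace τ))
  rw [StarSubalgebra.mem_centralizer_iff]
  intro T hT
  exact ⟨commute_leftRep (fun R hR => ((StarSubalgebra.mem_centralizer_iff ℂ).1 hT R hR).1) a,
    commute_leftRep (fun R hR => ((StarSubalgebra.mem_centralizer_iff ℂ).1
      (star_mem hT) R hR).1) a⟩

end Commutant

/-! ### The truncated modular operator -/

section Modular
variable (τ : FaithfulTrace n)

/-- The projection `∑_{|k| ≤ N} Φ_k`. -/
def specCut (N : ℕ) : HilbSpace τ →L[ℂ] HilbSpace τ := ∑ k ∈ Finset.Icc (-(N : ℤ)) N, specProj τ k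

/-- The operator `∑_{|k| ≤ N} n⁻ᵏ Φ_k`. -/
def modularSum (N : ℕ) : HilbSpace τ →L[ℂ] HilbSpace τ :=
  ∑ k ∈ Finset.Icc (-(N : ℤ)) N, (n : ℂ) ^ (-k) • specProj τ k

variable {τ}

lemma kms_mul_star_sum [NeZero n] {N : ℕ} {a : CuntzAlgebra n} (ha : a ∈ polyAlgebra n)
    {c : ℤ → CuntzAlgebra n} (hc : ∀ k, c k ∈ gradedPoly n k) {η : HilbSpace τ}
    (hη : ∀ k, specProj τ k η = toHilb τ (c k)) :
    kms τ (a * star (∑ k ∈ Finset.Icc (-(N : ℤ)) N, c k)) = ⟪modularSum τ N η, toHilb τ a⟫_ℂ := by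
  rw [modularSum, sum_apply, sum_inner, star_sum, Finset.mul_sum, map_sum]
  refine Finset.sum_congr rfl fun k _ => ?_
  rw [kms_mul_star τ ha (hc k), smul_apply, hη, inner_smul_left, inner_toHilb]
  simp

lemma norm_toHilb_star_sum_le [NeZero n] (N : ℕ)
    {c : ℤ → CuntzAlgebra n} (hc : ∀ k, c k ∈ gradedPoly n k) {η : HilbSpace τ}
    (hη : ∀ k, specProj τ k η = toHilb τ (c k)) :
    ‖toHilb τ (star (∑ k ∈ Finset.Icc (-(N : ℤ)) N, c k))‖ ≤
      √(‖modularSum τ N‖ * ‖specCut τ N‖) * ‖η‖ := by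
  set d := ∑ k ∈ Finset.Icc (-(N : ℤ)) N, c k with hd
  have hdp : d ∈ polyAlgebra n := sum_mem fun k _ => gradedPoly_le k (hc k)
  have h1 : toHilb τ d = specCut τ N η := by
    rw [hd, toHilb_sum, specCut, sum_apply]
    exact Finset.sum_congr rfl fun k _ => (hη k).symm
  have h2 : ‖toHilb τ (star d)‖ ^ 2 ≤ (‖modularSum τ N‖ * ‖specCut τ N‖) * ‖η‖ ^ 2 := by
    rw [norm_toHilb_sq, star_star, kms_mul_star_sum hdp hc hη, h1]
    calc _ ≤ ‖⟪modularSum τ N η, specCut τ N η⟫_ℂ‖ := Complex.re_le_norm _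
      _ ≤ ‖modularSum τ N η‖ * ‖specCut τ N η‖ := norm_inner_le_norm _ _
      _ ≤ (‖modularSum τ N‖ * ‖η‖) * (‖specCut τ N‖ * ‖η‖) := by
          gcongr <;> exact ContinuousLinearMap.le_opNorm _ _
      _ = _ := by ring
  refine le_of_sq_le_sq ?_ (by positivity)
  rwa [mul_pow, Real.sq_sqrt (by positivity)]

/-- The bounded operator `∑_{|k| ≤ N} n⁻ᵏ Φ_k` is the modular operator on the range of the cut-off:
approximating `ξ` by elements of `O_{nc}`, the adjoints of their truncations converge as well. -/
lemma modularSum_mem [NeZero n] (N : ℕ) (ξ : HilbSpace τ) :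
    (specCut τ N ξ, modularSum τ N ξ) ∈ modularGraph τ := by
  obtain ⟨x, hx, hxξ⟩ := mem_closure_iff_seq_limit.1 (dense_toHilb_polyAlgebra τ ξ)
  choose b hb hbx using hx
  choose c hc hcb using fun m k => exists_specProj_toHilb (τ := τ) (hb m) k
  simp only [hbx] at hcb
  set d : ℕ → CuntzAlgebra n := fun m => ∑ k ∈ Finset.Icc (-(N : ℤ)) N, c m k with hd
  have hdp : ∀ m, d m ∈ polyAlgebra n := fun m => sum_mem fun k _ => gradedPoly_le k (hc m k)
  have h1 : ∀ m, toHilb τ (d m) = specCut τ N (x m) := fun m => by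
    rw [hd, toHilb_sum, specCut, sum_apply]
    exact Finset.sum_congr rfl fun k _ => (hcb m k).symm
  have hcau : CauchySeq fun m => toHilb τ (star (d m)) := by
    set K := √(‖modularSum τ N‖ * ‖specCut τ N‖)
    have hK : ∀ m l, dist (toHilb τ (star (d m))) (toHilb τ (star (d l))) ≤
        (K + 1) * dist (x m) (x l) := fun m l => by
      rw [dist_eq_norm, dist_eq_norm, ← toHilb_sub, ← star_sub, hd, ← Finset.sum_sub_distrib]
      refine (norm_toHilb_star_sum_le N (c := fun k => c m k - c l k)
        (fun k => sub_mem (hc m k) (hc l k)) (η := x m - x l) fun k => ?_).trans ?_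
      · rw [map_sub, hcb, hcb, toHilb_sub]
      · gcongr
        exact le_add_of_nonneg_right zero_le_one
    have hx := Metric.cauchySeq_iff.1 hxξ.cauchySeq
    rw [Metric.cauchySeq_iff]
    intro ε hε
    have hK0 : 0 < K + 1 := by positivity
    obtain ⟨M, hM⟩ := hx (ε / (K + 1)) (by positivity)
    refine ⟨M, fun m hm l hl => (hK m l).trans_lt ?_⟩
    have := hM m hm l hl
    rwa [lt_div_iff₀' hK0] at this
  obtain ⟨ζ, hζ⟩ := cauchySeq_tendsto_of_complete hcau
  refine ⟨ζ, ?_, fun a ha => ?_⟩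
  · refine mem_closure_of_tendsto (((specCut τ N).continuous.tendsto ξ).comp hxξ |>.prodMk_nhds hζ)
      (Eventually.of_forall fun m => ⟨d m, hdp m, ?_⟩)
    rw [Function.comp_apply, h1]
  · refine tendsto_nhds_unique (tendsto_const_nhds.inner hζ)
      ((((modularSum τ N).continuous.tendsto ξ).comp hxξ |>.inner tendsto_const_nhds).congr
        fun m => ?_)
    rw [Function.comp_apply, ← kms_mul_star_sum ha (hc m) (hcb m), inner_toHilb, star_star]

lemma modularCut_mem [NeZero n] (N : ℕ) (ξ : HilbSpace τ) :
    (specCut τ N ξ, modularCut τ N ξ) ∈ modularGraph τ := by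
  have h := Classical.epsilon_spec (p := fun R : HilbSpace τ →L[ℂ] HilbSpace τ =>
    ∀ ξ, ((∑ k ∈ Finset.Icc (-(N : ℤ)) N, specProj τ k) ξ, R ξ) ∈ modularGraph τ)
    ⟨modularSum τ N, modularSum_mem N⟩
  exact h ξ

lemma inner_of_mem_tomitaGraph [NeZero n] {k : ℤ} {c : CuntzAlgebra n} (hc : c ∈ gradedPoly n k)
    {p : HilbSpace τ × HilbSpace τ} (hp : p ∈ tomitaGraph τ) :
    ⟪toHilb τ (star c), p.2⟫_ℂ = (n : ℂ) ^ (-k) * ⟪p.1, toHilb τ c⟫_ℂ := by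
  have hcl : IsClosed {p : HilbSpace τ × HilbSpace τ |
      ⟪toHilb τ (star c), p.2⟫_ℂ = (n : ℂ) ^ (-k) * ⟪p.1, toHilb τ c⟫_ℂ} :=
    isClosed_eq (by fun_prop) (by fun_prop)
  refine closure_minimal ?_ hcl hp
  rintro _ ⟨b, hb, rfl⟩
  have h := congrArg star (kms_mul_star τ hb hc)
  rw [← kms_star, star_mul, star_star, star_mul', ← kms_star, star_mul, star_star] at h
  change ⟪toHilb τ (star c), toHilb τ (star b)⟫_ℂ = _ * ⟪toHilb τ b, toHilb τ c⟫_ℂ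
  rw [inner_toHilb, inner_toHilb, star_star, h]
  simp

lemma inner_modularCut [NeZero n] (N : ℕ) {k : ℤ} {c : CuntzAlgebra n} (hc : c ∈ gradedPoly n k)
    (ξ : HilbSpace τ) : ⟪toHilb τ c, modularCut τ N ξ⟫_ℂ =
      if k ∈ Finset.Icc (-(N : ℤ)) N then (n : ℂ) ^ (-k) * ⟪toHilb τ c, ξ⟫_ℂ else 0 := by
  obtain ⟨ζ, hζ, h⟩ := modularCut_mem N ξ
  have hm := toHilb_mem_spectralSubspace (τ := τ) hc
  have h1 : ⟪specCut τ N ξ, toHilb τ c⟫_ℂ =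
      if k ∈ Finset.Icc (-(N : ℤ)) N then ⟪ξ, toHilb τ c⟫_ℂ else 0 := by
    rw [specCut, sum_apply, sum_inner, ← Finset.sum_ite_eq' _ k fun _ => ⟪ξ, toHilb τ c⟫_ℂ]
    refine Finset.sum_congr rfl fun j _ => ?_
    rw [specProj, inner_closureProj, ← specProj]
    split_ifs with hjk
    · rw [hjk, specProj_of_mem hm]
    · rw [specProj_of_mem_ne (Ne.symm hjk) hm, inner_zero_right]
  have h2 : ⟪modularCut τ N ξ, toHilb τ c⟫_ℂ = (n : ℂ) ^ (-k) * ⟪specCut τ N ξ, toHilb τ c⟫_ℂ :=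
    (h c (gradedPoly_le k hc)).symm.trans (inner_of_mem_tomitaGraph hc hζ)
  rw [h1] at h2
  rw [← inner_conj_symm, h2]
  split_ifs
  · rw [map_mul, inner_conj_symm]
    simp
  · simp

end Modular
/-! ### The weight as a series over the spectral degrees -/

section Weight
variable {τ : FaithfulTrace n}

lemma word_mem_gradedPoly (μ : List (Fin n)) : word μ ∈ gradedPoly n (μ.length : ℤ) := by
  simpa using monomial_mem_gradedPoly μ []

lemma star_word_mem_gradedPoly (μ : List (Fin n)) :
    star (word μ) ∈ gradedPoly n (-(μ.length : ℤ)) := by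
  simpa using monomial_mem_gradedPoly [] μ

lemma vecState_eq (a : CuntzAlgebra n) (T : HilbSpace τ →L[ℂ] HilbSpace τ) :
    vecState τ a T = ⟪toHilb τ a, T (toHilb τ a)⟫_ℂ := rfl

lemma norm_vecState_le (a : CuntzAlgebra n) (T : HilbSpace τ →L[ℂ] HilbSpace τ) :
    ‖vecState τ a T‖ ≤ (kms τ (star a * a)).re * ‖T‖ := by
  rw [← norm_toHilb_sq]
  calc ‖vecState τ a T‖ ≤ ‖toHilb τ a‖ * (‖T‖ * ‖toHilb τ a‖) :=
        (norm_inner_le_norm _ _).trans (by gcongr; exact T.le_opNorm _)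
    _ = _ := by ring

lemma vecState_leftRep (a b : CuntzAlgebra n) :
    vecState τ a (leftRep τ b) = kms τ (star a * (b * a)) := by
  rw [vecState_eq, leftRep_toHilb, inner_toHilb]

lemma vecState_nonneg (a : CuntzAlgebra n) {T : HilbSpace τ →L[ℂ] HilbSpace τ}
    (hT : T.IsPositive) : 0 ≤ vecState τ a T := hT.inner_nonneg_right _

lemma vecState_modularCut_mul [NeZero n] (N : ℕ) {k : ℤ} {c : CuntzAlgebra n}
    (hc : c ∈ gradedPoly n k) {s : ℝ} (hs : 1 < s) (T : HilbSpace τ →L[ℂ] HilbSpace τ) :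
    vecState τ c (modularCut τ N * (T * resolventPow τ s)) =
      if k ∈ Finset.Icc (-(N : ℤ)) N then
        (n : ℂ) ^ (-k) * ((((1 + (k : ℝ) ^ 2) ^ (-s / 2) : ℝ) : ℂ) * vecState τ c T) else 0 := by
  rw [vecState_eq, mul_apply_eq_comp, inner_modularCut N hc, mul_apply_eq_comp,
    resolventPow_apply hs (toHilb_mem_spectralSubspace hc), map_smul, inner_smul_right]
  rfl

/-- The contribution of the degrees `k` and `-k` to the weight `τ_Δ`: the sum of two states if
`k ≥ 1`, each of which restricts to `ψ` on `O_n`. -/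
def levelState (τ : FaithfulTrace n) (k : ℕ) (T : HilbSpace τ →L[ℂ] HilbSpace τ) : ℂ :=
  ∑ μ ∈ wordsOfLength n k, (((n : ℂ) ^ k)⁻¹ * vecState τ (word μ) T + vecState τ (star (word μ)) T)

lemma kms_word_mul_star [NeZero n] (μ : List (Fin n)) :
    kms τ (word μ * star (word μ)) = ((n : ℂ) ^ μ.length)⁻¹ := by
  rw [kms_monomial, if_pos rfl]

lemma norm_levelState_le [NeZero n] (k : ℕ) (T : HilbSpace τ →L[ℂ] HilbSpace τ) :
    ‖levelState τ k T‖ ≤ 2 * ‖T‖ := by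
  have hn : (n : ℝ) ≠ 0 := NeZero.ne _
  have h : ∀ μ ∈ wordsOfLength n k, ‖((n : ℂ) ^ k)⁻¹ * vecState τ (word μ) T +
      vecState τ (star (word μ)) T‖ ≤ ((n : ℝ) ^ k)⁻¹ * (2 * ‖T‖) := fun μ hμ => by
    rw [mem_wordsOfLength] at hμ
    have h1 := norm_vecState_le (word μ) T
    have h2 := norm_vecState_le (star (word μ)) T
    rw [star_word_mul_self, kms_one, Complex.one_re, one_mul] at h1
    have h3 : (((n : ℂ) ^ μ.length)⁻¹).re = ((n : ℝ) ^ k)⁻¹ := by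
      rw [hμ, ← Complex.ofReal_natCast, ← Complex.ofReal_pow, ← Complex.ofReal_inv,
        Complex.ofReal_re]
    rw [star_star, kms_word_mul_star, h3] at h2
    refine (norm_add_le _ _).trans ?_
    rw [norm_mul, norm_inv, norm_pow, Complex.norm_natCast]
    calc _ ≤ ((n : ℝ) ^ k)⁻¹ * ‖T‖ + ((n : ℝ) ^ k)⁻¹ * ‖T‖ := by gcongr
      _ = _ := by ring
  refine (norm_sum_le_of_le _ h).trans (le_of_eq ?_)
  rw [Finset.sum_const, card_wordsOfLength, nsmul_eq_mul, Nat.cast_pow,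
    mul_inv_cancel_left₀ (pow_ne_zero _ hn)]

lemma levelState_add (k : ℕ) (S T : HilbSpace τ →L[ℂ] HilbSpace τ) :
    levelState τ k (S + T) = levelState τ k S + levelState τ k T := by
  simp only [levelState, vecState_eq, add_apply, inner_add_right, ← Finset.sum_add_distrib]
  exact Finset.sum_congr rfl fun _ _ => by ring

lemma levelState_smul (k : ℕ) (c : ℂ) (T : HilbSpace τ →L[ℂ] HilbSpace τ) :
    levelState τ k (c • T) = c * levelState τ k T := by
  simp only [levelState, vecState_eq, smul_apply, inner_smul_right, Finset.mul_sum]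
  exact Finset.sum_congr rfl fun _ _ => by ring

lemma levelState_nonneg (k : ℕ) {T : HilbSpace τ →L[ℂ] HilbSpace τ} (hT : T.IsPositive) :
    0 ≤ levelState τ k T := by
  refine Finset.sum_nonneg fun μ _ => add_nonneg (mul_nonneg ?_ (vecState_nonneg _ hT))
    (vecState_nonneg _ hT)
  rw [← Complex.ofReal_natCast, ← Complex.ofReal_pow, ← Complex.ofReal_inv]
  exact Complex.zero_le_real.2 (by positivity)

/-- On `O_n` all the level states are multiples of `ψ`, by the modular property of `ψ`. -/
lemma levelState_leftRep [NeZero n] (k : ℕ) (a : CuntzAlgebra n) :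
    levelState τ k (leftRep τ a) = 2 * kms τ a := by
  have hn : (n : ℂ) ≠ 0 := NeZero.ne _
  refine dense_polyAlgebra.induction
    (P := fun a : CuntzAlgebra n => levelState τ k (leftRep τ a) = 2 * kms τ a) ?_ ?_ a
  · intro a ha
    have h1 : ∀ μ ∈ wordsOfLength n k,
        ((n : ℂ) ^ k)⁻¹ * vecState τ (word μ) (leftRep τ a) +
          vecState τ (star (word μ)) (leftRep τ a) =
        kms τ (a * (word μ * star (word μ))) + ((n : ℂ) ^ k)⁻¹ * kms τ a := fun μ hμ => by
      rw [mem_wordsOfLength] at hμ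
      rw [vecState_leftRep, vecState_leftRep, star_star, ← mul_assoc a,
        kms_mul_star_word τ μ (mul_word_mem μ ha), kms_word_mul τ μ, mul_assoc a,
        star_word_mul_self, mul_one, hμ]
      exact mul_mem_polyAlgebra ha (star_mem_polyAlgebra (word_mem μ))
    rw [levelState, Finset.sum_congr rfl h1, Finset.sum_add_distrib, ← map_sum, ← Finset.mul_sum,
      sum_word_mul_star, mul_one, Finset.sum_const, card_wordsOfLength, nsmul_eq_mul, Nat.cast_pow,
      mul_inv_cancel_left₀ (pow_ne_zero _ hn), two_mul]
  · refine isClosed_eq ?_ (continuous_const.mul (map_continuous (kms τ)))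
    have h2 : ∀ b : CuntzAlgebra n, Continuous fun a => vecState τ b (leftRep τ a) := fun b => by
      simp only [vecState_eq]
      exact continuous_const.inner ((map_continuous (leftRep τ)).clm_apply continuous_const)
    exact continuous_finsetSum _ fun μ _ => (continuous_const.mul (h2 _)).add (h2 _)

lemma tauTilde_modularCut [NeZero n] (N : ℕ) {s : ℝ} (hs : 1 < s)
    (T : HilbSpace τ →L[ℂ] HilbSpace τ) :
    tauTilde τ (modularCut τ N * (T * resolventPow τ s)) = vecState τ 1 T +
      ∑ k ∈ Finset.range N,
        (((1 + ((k + 1 : ℕ) : ℝ) ^ 2) ^ (-s / 2) : ℝ) : ℂ) * levelState τ (k + 1) T := by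
  have hn : (n : ℂ) ≠ 0 := NeZero.ne _
  have h0 : vecState τ 1 (modularCut τ N * (T * resolventPow τ s)) = vecState τ 1 T := by
    rw [vecState_modularCut_mul N (k := 0) (by simpa using word_mem_gradedPoly (n := n) []) hs,
      if_pos (by simp)]
    simp
  set X := modularCut τ N * (T * resolventPow τ s) with hX
  set f : List (Fin n) → ℂ := fun μ =>
    vecState τ (word μ) X + (1 / (n : ℂ) ^ μ.length) * vecState τ (star (word μ)) X with hf
  have hfμ : ∀ μ, f μ = if μ.length ≤ N then
      (((1 + (μ.length : ℝ) ^ 2) ^ (-s / 2) : ℝ) : ℂ) * (((n : ℂ) ^ μ.length)⁻¹ *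
        vecState τ (word μ) T + vecState τ (star (word μ)) T) else 0 := fun μ => by
    simp only [hf, hX]
    rw [vecState_modularCut_mul N (word_mem_gradedPoly μ) hs,
      vecState_modularCut_mul N (star_word_mem_gradedPoly μ) hs]
    by_cases h : μ.length ≤ N
    · rw [if_pos (Finset.mem_Icc.2 (by omega)), if_pos (Finset.mem_Icc.2 (by omega)), if_pos h,
        neg_neg, zpow_neg, zpow_natCast]
      push_cast
      rw [neg_sq]
      field_simp
    · rw [if_neg (fun h' => h (by have := Finset.mem_Icc.1 h'; omega)),
        if_neg (fun h' => h (by have := Finset.mem_Icc.1 h'; omega)), if_neg h, mul_zero, add_zero]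
  rw [tauTilde, h0]
  congr 1
  change ∑' μ : {μ : List (Fin n) | μ ≠ []}, f μ = _
  rw [tsum_subtype {μ : List (Fin n) | μ ≠ []} f,
    tsum_eq_sum (s := (Finset.range N).biUnion fun k => wordsOfLength n (k + 1)),
    Finset.sum_biUnion]
  · refine Finset.sum_congr rfl fun k hk => ?_
    rw [levelState, Finset.mul_sum]
    refine Finset.sum_congr rfl fun μ hμ => ?_
    rw [mem_wordsOfLength] at hμ
    have h1 : μ ∈ {μ : List (Fin n) | μ ≠ []} := fun h => by simp [h] at hμ
    have h2 := Finset.mem_range.1 hk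
    rw [Set.indicator_of_mem h1, hfμ, hμ, if_pos (by omega)]
  · intro j _ k _ hjk
    refine Finset.disjoint_left.2 fun μ hj hk => hjk ?_
    rw [mem_wordsOfLength] at hj hk
    omega
  · intro μ hμ
    by_cases h1 : μ ∈ {μ : List (Fin n) | μ ≠ []}
    · rw [Set.indicator_of_mem h1, hfμ, if_neg]
      intro h2
      have h3 := List.length_pos_iff.2 h1
      exact hμ (Finset.mem_biUnion.2 ⟨μ.length - 1, Finset.mem_range.2 (by omega),
        mem_wordsOfLength.2 (by omega)⟩)
    · exact Set.indicator_of_notMem h1 _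

lemma summable_levelState [NeZero n] {s : ℝ} (hs : 1 < s) (T : HilbSpace τ →L[ℂ] HilbSpace τ) :
    Summable fun k : ℕ =>
      (((1 + ((k + 1 : ℕ) : ℝ) ^ 2) ^ (-s / 2) : ℝ) : ℂ) * levelState τ (k + 1) T := by
  refine Summable.of_norm_bounded
    (((summable_nat_add_iff 1).2 (summable_weight hs)).mul_right (2 * ‖T‖)) fun k => ?_
  rw [norm_mul, Complex.norm_real, Real.norm_of_nonneg (by positivity)]
  gcongr
  exact norm_levelState_le _ _

/-- The value `∑ k, (1 + k²)^{-s/2} φ_k(T)`, over `k ∈ ℤ` with the states `φ_k` of degree `k`, of the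
weight `τ_Δ` at `T (1 + D²)^{-s/2}`. -/
def weightSeries (τ : FaithfulTrace n) (T : HilbSpace τ →L[ℂ] HilbSpace τ) (s : ℝ) : ℂ :=
  vecState τ 1 T +
    ∑' k : ℕ, (((1 + ((k + 1 : ℕ) : ℝ) ^ 2) ^ (-s / 2) : ℝ) : ℂ) * levelState τ (k + 1) T

lemma tendsto_tauTilde [NeZero n] {s : ℝ} (hs : 1 < s) (T : HilbSpace τ →L[ℂ] HilbSpace τ) :
    Tendsto (fun N : ℕ => tauTilde τ (modularCut τ N * (T * resolventPow τ s))) atTop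
      (𝓝 (weightSeries τ T s)) := by
  simp only [tauTilde_modularCut _ hs]
  exact ((summable_levelState hs T).hasSum.tendsto_sum_nat).const_add _

lemma weightedZeta_eq [NeZero n] {s : ℝ} (hs : 1 < s) (T : HilbSpace τ →L[ℂ] HilbSpace τ) :
    weightedZeta τ T s = ((s - 1 : ℝ) : ℂ) * weightSeries τ T s := by
  rw [weightedZeta, tauDelta, (tendsto_tauTilde hs T).limUnder_eq]

lemma weightSeries_add [NeZero n] {s : ℝ} (hs : 1 < s) (S T : HilbSpace τ →L[ℂ] HilbSpace τ) :
    weightSeries τ (S + T) s = weightSeries τ S s + weightSeries τ T s := by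
  simp only [weightSeries, levelState_add, mul_add, vecState_eq, add_apply, inner_add_right]
  rw [(summable_levelState hs S).tsum_add (summable_levelState hs T)]
  ring

lemma weightSeries_smul (s : ℝ) (c : ℂ) (T : HilbSpace τ →L[ℂ] HilbSpace τ) :
    weightSeries τ (c • T) s = c * weightSeries τ T s := by
  simp only [weightSeries, levelState_smul, vecState_eq, smul_apply, inner_smul_right,
    mul_left_comm _ c, tsum_mul_left, mul_add]

lemma weightSeries_nonneg (s : ℝ) {T : HilbSpace τ →L[ℂ] HilbSpace τ} (hT : T.IsPositive) :
    0 ≤ weightSeries τ T s :=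
  add_nonneg (vecState_nonneg _ hT) (tsum_nonneg fun k =>
    mul_nonneg (Complex.zero_le_real.2 (by positivity)) (levelState_nonneg _ hT))

end Weight

/-! ### The residue at `s = 1` -/

/-- The series `∑_{k ∈ ℤ} (1 + k²)^{-s/2}`, which is the weight `τ_Δ((1 + D²)^{-s/2})`. -/
def latticeZeta (s : ℝ) : ℝ := 1 + 2 * ∑' k : ℕ, (1 + ((k + 1 : ℕ) : ℝ) ^ 2) ^ (-s / 2)

lemma weightSeries_leftRep [NeZero n] (τ : FaithfulTrace n) (a : CuntzAlgebra n) (s : ℝ) :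
    weightSeries τ (leftRep τ a) s = kms τ a * (latticeZeta s : ℂ) := by
  simp only [weightSeries, levelState_leftRep, vecState_leftRep, star_one, one_mul, mul_one,
    tsum_mul_right, latticeZeta]
  push_cast
  ring

lemma norm_weightSeries_le [NeZero n] {τ : FaithfulTrace n} {s : ℝ} (hs : 1 < s)
    (T : HilbSpace τ →L[ℂ] HilbSpace τ) : ‖weightSeries τ T s‖ ≤ ‖T‖ * latticeZeta s := by
  have hsum := (summable_nat_add_iff 1).2 (summable_weight hs)
  have h1 := norm_vecState_le (τ := τ) 1 T
  rw [star_one, one_mul, kms_one, Complex.one_re, one_mul] at h1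
  have h2 : ‖∑' k : ℕ, (((1 + ((k + 1 : ℕ) : ℝ) ^ 2) ^ (-s / 2) : ℝ) : ℂ) *
      levelState τ (k + 1) T‖ ≤ (∑' k : ℕ, (1 + ((k + 1 : ℕ) : ℝ) ^ 2) ^ (-s / 2)) * (2 * ‖T‖) := by
    refine tsum_of_norm_bounded (hsum.hasSum.mul_right (2 * ‖T‖)) fun k => ?_
    rw [norm_mul, Complex.norm_real, Real.norm_of_nonneg (by positivity)]
    gcongr
    exact norm_levelState_le _ _
  rw [latticeZeta]
  refine (norm_add_le _ _).trans ?_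
  linarith

/-- The comparison `(k + 1)⁻ˢ ≤ (1 + k²)^{-s/2} ≤ k⁻ˢ` for `k ≥ 1` reduces this to the simple pole of
the Riemann zeta function. -/
lemma tendsto_mul_latticeZeta :
    Tendsto (fun s : ℝ => (s - 1) * latticeZeta s) (𝓝[>] 1) (𝓝 2) := by
  have hz := tendsto_sub_mul_tsum_nat_rpow
  have hs1 : Tendsto (fun s : ℝ => s - 1) (𝓝[>] 1) (𝓝 0) := by
    have : Tendsto (fun s : ℝ => s - 1) (𝓝 1) (𝓝 (1 - 1)) := tendsto_id.sub_const 1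
    rw [sub_self] at this
    exact this.mono_left nhdsWithin_le_nhds
  have hlow : Tendsto (fun s : ℝ => 2 * ((s - 1) * ∑' k : ℕ, 1 / (k : ℝ) ^ s) - (s - 1)) (𝓝[>] 1)
      (𝓝 2) := by
    simpa using (hz.const_mul 2).sub hs1
  have hupp : Tendsto (fun s : ℝ => 2 * ((s - 1) * ∑' k : ℕ, 1 / (k : ℝ) ^ s) + (s - 1)) (𝓝[>] 1)
      (𝓝 2) := by
    simpa using (hz.const_mul 2).add hs1
  have hpow : ∀ (x s : ℝ), 0 < x → (x ^ 2) ^ (-s / 2) = 1 / x ^ s := fun x s hx => by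
    rw [← Real.rpow_natCast, ← Real.rpow_mul hx.le, one_div, ← Real.rpow_neg hx.le]
    congr 1
    push_cast
    ring
  refine tendsto_of_tendsto_of_tendsto_of_le_of_le' hlow hupp ?_ ?_
  · filter_upwards [self_mem_nhdsWithin] with s hs
    have hs : 1 < s := hs
    have hsum := Real.summable_one_div_nat_rpow.2 hs
    have hsum1 := (summable_nat_add_iff 1).2 hsum
    have hsum2 := (summable_nat_add_iff 1).2 hsum1
    have hle : ∑' k : ℕ, 1 / ((k + 1 + 1 : ℕ) : ℝ) ^ s ≤
        ∑' k : ℕ, (1 + ((k + 1 : ℕ) : ℝ) ^ 2) ^ (-s / 2) := by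
      refine hsum2.tsum_le_tsum (fun k => ?_) ((summable_nat_add_iff 1).2 (summable_weight hs))
      rw [← hpow _ _ (by positivity)]
      refine Real.rpow_le_rpow_of_nonpos (by positivity) ?_ (by linarith)
      push_cast
      nlinarith [(Nat.cast_nonneg k : (0 : ℝ) ≤ k)]
    have h1 := hsum.tsum_eq_zero_add
    have h2 := hsum1.tsum_eq_zero_add
    rw [Nat.cast_zero, Real.zero_rpow (by linarith), div_zero, zero_add] at h1
    rw [zero_add, Nat.cast_one, Real.one_rpow, div_one] at h2
    rw [latticeZeta, h1, h2]
    nlinarith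
  · filter_upwards [self_mem_nhdsWithin] with s hs
    have hs : 1 < s := hs
    have hsum := Real.summable_one_div_nat_rpow.2 hs
    have hsum1 := (summable_nat_add_iff 1).2 hsum
    have hle : ∑' k : ℕ, (1 + ((k + 1 : ℕ) : ℝ) ^ 2) ^ (-s / 2) ≤
        ∑' k : ℕ, 1 / ((k + 1 : ℕ) : ℝ) ^ s := by
      refine ((summable_nat_add_iff 1).2 (summable_weight hs)).tsum_le_tsum (fun k => ?_) hsum1
      rw [← hpow _ _ (by positivity)]
      exact Real.rpow_le_rpow_of_nonpos (by positivity) (by linarith) (by linarith)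
    have h1 := hsum.tsum_eq_zero_add
    rw [Nat.cast_zero, Real.zero_rpow (by linarith), div_zero, zero_add] at h1
    rw [latticeZeta, h1]
    nlinarith
/-! ### Generalised limits -/

instance neBot_atTop_inf_ae_halfLine : (atTop ⊓ ae halfLine : Filter ℝ).NeBot := by
  rw [Filter.inf_neBot_iff]
  intro s hs t ht
  obtain ⟨a, ha⟩ := mem_atTop_sets.1 hs
  by_contra h
  have h1 : Set.Ioi (max a 0) ⊆ tᶜ := fun x hx hxt =>
    h ⟨x, ha x ((le_max_left _ _).trans (le_of_lt hx)), hxt⟩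
  have h2 : halfLine (Set.Ioi (max a 0)) = 0 := measure_mono_null h1 (mem_ae_iff.1 ht)
  rw [Measure.restrict_apply measurableSet_Ioi, Set.inter_eq_left.2
    (Set.Ioi_subset_Ioi (le_max_right _ _)), Real.volume_Ioi] at h2
  exact ENNReal.top_ne_zero h2

namespace GeneralizedLimit
variable (ω : GeneralizedLimit)

lemma im_apply_toLp {g : ℝ → ℝ} (hg : MemLp (fun t => (g t : ℂ)) ∞ halfLine) :
    (ω.toLinearMap (hg.toLp _)).im = 0 := by
  set f := hg.toLp _ with hf
  set e : Lp ℂ ∞ halfLine := (memLp_top_const (1 : ℂ)).toLp _ with he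
  have h1 : 0 ≤ ω.toLinearMap (((‖f‖ : ℝ) : ℂ) • e - f) := by
    refine ω.map_nonneg' _ ?_
    filter_upwards [Lp.coeFn_sub (((‖f‖ : ℝ) : ℂ) • e) f, Lp.coeFn_smul ((‖f‖ : ℝ) : ℂ) e,
      (memLp_top_const (μ := halfLine) (1 : ℂ)).coeFn_toLp, hg.coeFn_toLp,
      ae_le_eLpNormEssSup (f := f) (μ := halfLine)] with t h1 h2 h3 h4 h5
    rw [h1, Pi.sub_apply, h2, Pi.smul_apply, he, h3]
    rw [← hf] at h4
    have h6 : ‖f t‖ ≤ ‖f‖ := by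
      rw [Lp.norm_def, eLpNorm_exponent_top]
      refine (ENNReal.ofReal_le_iff_le_toReal ?_).1 ((ofReal_norm _).trans_le h5)
      rw [← eLpNorm_exponent_top]
      exact Lp.eLpNorm_ne_top f
    rw [h4, Complex.norm_real] at h6
    rw [h4]
    rw [smul_eq_mul, mul_one, ← Complex.ofReal_sub]
    exact Complex.zero_le_real.2 (sub_nonneg.2 ((le_abs_self _).trans h6))
  have h2 : ω.toLinearMap e = 1 := ω.map_one'
  rw [map_sub, map_smul, h2, smul_eq_mul, mul_one] at h1
  have h3 := (Complex.le_def.1 h1).2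
  simpa using h3

lemma apply_toLp_of_tendsto {g : ℝ → ℝ} (hg : MemLp (fun t => (g t : ℂ)) ∞ halfLine) {c : ℝ}
    (h : Tendsto g (atTop ⊓ ae halfLine) (𝓝 c)) : ω.toLinearMap (hg.toLp _) = c := by
  refine Complex.ext ?_ (ω.im_apply_toLp hg)
  have h1 := ω.liminf_le' g hg
  have h2 := ω.le_limsup' g hg
  rw [h.liminf_eq] at h1
  rw [h.limsup_eq] at h2
  exact le_antisymm h2 h1

/-- The value of a generalised limit depends only on the behaviour near infinity. -/
lemma apply_congr {f f' : Lp ℂ ∞ halfLine} (h : ∀ᶠ t in atTop ⊓ ae halfLine, f t = f' t) :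
    ω.toLinearMap f = ω.toLinearMap f' := by
  set d := f - f' with hd
  have hd0 : ∀ᶠ t in atTop ⊓ ae halfLine, d t = 0 := by
    filter_upwards [h, (Lp.coeFn_sub f f').filter_mono inf_le_right] with t h1 h2
    rw [hd, h2, Pi.sub_apply, h1, sub_self]
  have hre : MemLp (fun t => ((d t).re : ℂ)) ∞ halfLine := (Lp.memLp d).re.ofReal
  have him : MemLp (fun t => ((d t).im : ℂ)) ∞ halfLine := (Lp.memLp d).im.ofReal
  have hsum : d = hre.toLp _ + Complex.I • him.toLp _ := by
    refine Lp.ext ?_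
    filter_upwards [Lp.coeFn_add (hre.toLp _) (Complex.I • him.toLp _),
      Lp.coeFn_smul Complex.I (him.toLp _), hre.coeFn_toLp, him.coeFn_toLp] with t h1 h2 h3 h4
    rw [h1, Pi.add_apply, h2, Pi.smul_apply, h3, h4, smul_eq_mul, mul_comm, Complex.re_add_im]
  have h1 : ω.toLinearMap (hre.toLp _) = (0 : ℝ) := ω.apply_toLp_of_tendsto hre <|
    tendsto_const_nhds.congr' (hd0.mono fun t ht => by simp only [ht, Complex.zero_re])
  have h2 : ω.toLinearMap (him.toLp _) = (0 : ℝ) := ω.apply_toLp_of_tendsto him <|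
    tendsto_const_nhds.congr' (hd0.mono fun t ht => by simp only [ht, Complex.zero_im])
  rw [← sub_eq_zero, ← map_sub, ← hd, hsum, map_add, map_smul, h1, h2]
  simp

variable {ω} {g g' : ℝ → ℂ} {c c' : ℂ}

lemma hasLim_apply {f : Lp ℂ ∞ halfLine} (h : ∀ᶠ t in atTop ⊓ ae halfLine, f t = g t) :
    ω.HasLim g (ω.toLinearMap f) :=
  ⟨⟨f, h⟩, fun f' h' => ω.apply_congr (by filter_upwards [h, h'] with t h1 h2; rw [h1, h2])⟩

lemma HasLim.unique (h : ω.HasLim g c) (h' : ω.HasLim g c') : c = c' := by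
  obtain ⟨f, hf⟩ := h.1
  rw [← h.2 f hf, ← h'.2 f hf]

lemma HasLim.lim_eq (h : ω.HasLim g c) : ω.lim g = c :=
  HasLim.unique (Classical.epsilon_spec (p := ω.HasLim g) ⟨c, h⟩) h

lemma HasLim.congr (h : ω.HasLim g c) (hg : g =ᶠ[atTop] g') : ω.HasLim g' c := by
  obtain ⟨f, hf⟩ := h.1
  rw [← h.2 f hf]
  refine hasLim_apply ?_
  filter_upwards [hf, hg.filter_mono inf_le_left] with t h1 h2
  rw [h1, h2]

lemma HasLim.add (h : ω.HasLim g c) (h' : ω.HasLim g' c') :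
    ω.HasLim (fun t => g t + g' t) (c + c') := by
  obtain ⟨f, hf⟩ := h.1
  obtain ⟨f', hf'⟩ := h'.1
  rw [← h.2 f hf, ← h'.2 f' hf', ← map_add]
  refine hasLim_apply ?_
  filter_upwards [hf, hf', (Lp.coeFn_add f f').filter_mono inf_le_right] with t h1 h2 h3
  rw [h3, Pi.add_apply, h1, h2]

lemma HasLim.const_mul (h : ω.HasLim g c) (r : ℂ) : ω.HasLim (fun t => r * g t) (r * c) := by
  obtain ⟨f, hf⟩ := h.1
  rw [← h.2 f hf, ← smul_eq_mul, ← map_smul]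
  refine hasLim_apply ?_
  filter_upwards [hf, (Lp.coeFn_smul r f).filter_mono inf_le_right] with t h1 h2
  rw [h2, Pi.smul_apply, h1, smul_eq_mul]

lemma hasLim_of_memLp {R : ℝ} (h : MemLp ((Set.Ioi R).indicator g) ∞ halfLine) :
    ω.HasLim g (ω.toLinearMap (h.toLp _)) := by
  refine hasLim_apply ?_
  filter_upwards [h.coeFn_toLp.filter_mono inf_le_right,
    (eventually_gt_atTop R).filter_mono inf_le_left] with t h1 h2
  rw [h1, Set.indicator_of_mem (Set.mem_Ioi.2 h2)]

lemma HasLim.nonneg (h : ω.HasLim g c) {R : ℝ}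
    (hg : MemLp ((Set.Ioi R).indicator g) ∞ halfLine) (h0 : ∀ r ∈ Set.Ioi R, 0 ≤ g r) : 0 ≤ c := by
  rw [h.unique (hasLim_of_memLp hg)]
  refine ω.map_nonneg' _ ?_
  filter_upwards [hg.coeFn_toLp] with t ht
  rw [ht]
  exact Set.indicator_nonneg h0 t

lemma hasLim_of_tendsto {g : ℝ → ℝ} {R c : ℝ}
    (hg : MemLp ((Set.Ioi R).indicator fun t => (g t : ℂ)) ∞ halfLine)
    (h : Tendsto g atTop (𝓝 c)) : ω.HasLim (fun t => (g t : ℂ)) c := by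
  have h1 : (Set.Ioi R).indicator (fun t => (g t : ℂ)) =
      fun t => (((Set.Ioi R).indicator g t : ℝ) : ℂ) := by
    funext t
    by_cases ht : t ∈ Set.Ioi R <;> simp [ht]
  rw [h1] at hg
  rw [← ω.apply_toLp_of_tendsto hg ((h.congr' ?_).mono_left inf_le_left)]
  · refine hasLim_apply ?_
    filter_upwards [hg.coeFn_toLp.filter_mono inf_le_right,
      (eventually_gt_atTop R).filter_mono inf_le_left] with t h1 h2
    rw [h1, Set.indicator_of_mem (Set.mem_Ioi.2 h2)]
  · filter_upwards [eventually_gt_atTop R] with t ht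
    rw [Set.indicator_of_mem (Set.mem_Ioi.2 ht)]

end GeneralizedLimit

/-! ### The state on the von Neumann algebra -/

section State
variable {τ : FaithfulTrace n}

lemma tendsto_one_add_one_div : Tendsto (fun r : ℝ => 1 + 1 / r) atTop (𝓝[>] 1) := by
  rw [tendsto_nhdsWithin_iff]
  constructor
  · simpa using (tendsto_inv_atTop_zero (𝕜 := ℝ)).const_add 1
  · filter_upwards [eventually_gt_atTop 0] with r hr
    exact lt_add_of_pos_right 1 (one_div_pos.2 hr)

lemma tendsto_mul_latticeZeta_atTop :
    Tendsto (fun r : ℝ => 1 / r * latticeZeta (1 + 1 / r)) atTop (𝓝 2) := by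
  have h := tendsto_mul_latticeZeta.comp tendsto_one_add_one_div
  simpa only [Function.comp_def, add_sub_cancel_left] using h

lemma weightedZeta_one_add [NeZero n] {r : ℝ} (hr : 0 < r) (T : HilbSpace τ →L[ℂ] HilbSpace τ) :
    weightedZeta τ T (1 + 1 / r) = ((1 / r : ℝ) : ℂ) * weightSeries τ T (1 + 1 / r) := by
  rw [weightedZeta_eq (lt_add_of_pos_right 1 (by positivity)), add_sub_cancel_left]

lemma measurable_weightedZeta [NeZero n] {R : ℝ} (hR : 0 < R)
    (T : HilbSpace τ →L[ℂ] HilbSpace τ) :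
    Measurable ((Set.Ioi R).indicator fun r => weightedZeta τ T (1 + 1 / r)) := by
  refine measurable_of_tendsto_metrizable (f := fun N : ℕ => (Set.Ioi R).indicator fun r : ℝ =>
    ((1 / r : ℝ) : ℂ) * (vecState τ 1 T + ∑ k ∈ Finset.range N,
      (((1 + ((k + 1 : ℕ) : ℝ) ^ 2) ^ (-(1 + 1 / r) / 2) : ℝ) : ℂ) * levelState τ (k + 1) T))
    (fun N => Measurable.indicator (by fun_prop) measurableSet_Ioi) (tendsto_pi_nhds.2 fun r => ?_)
  by_cases hr : r ∈ Set.Ioi R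
  · have hr0 : 0 < r := hR.trans hr
    have hs : 1 < 1 + 1 / r := lt_add_of_pos_right 1 (by positivity)
    simp only [Set.indicator_of_mem hr, weightedZeta_one_add hr0]
    exact ((summable_levelState hs T).hasSum.tendsto_sum_nat.const_add _).const_mul _
  · simp only [Set.indicator_of_notMem hr, tendsto_const_nhds]

/-- The function `r ↦ (s - 1) τ_Δ(T (1 + D²)^{-s/2})`, `s = 1 + 1 / r`, is measurable and bounded
near infinity. -/
lemma exists_memLp_weightedZeta [NeZero n] (T : HilbSpace τ →L[ℂ] HilbSpace τ) :
    ∃ R > 0, MemLp ((Set.Ioi R).indicator fun r => weightedZeta τ T (1 + 1 / r)) ∞ halfLine := by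
  obtain ⟨R, hR⟩ := eventually_atTop.1
    ((tendsto_mul_latticeZeta_atTop.eventually_le_const (show (2 : ℝ) < 3 by norm_num)).and
      (eventually_gt_atTop 0))
  have hR0 : 0 < R := (hR R le_rfl).2
  refine ⟨R, hR0, memLp_top_of_bound (measurable_weightedZeta hR0 T).aestronglyMeasurable
    (‖T‖ * 3) (Eventually.of_forall fun r => ?_)⟩
  by_cases hr : r ∈ Set.Ioi R
  · obtain ⟨h1, h2⟩ := hR r (le_of_lt hr)
    rw [Set.indicator_of_mem hr, weightedZeta_one_add h2, norm_mul, Complex.norm_real,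
      Real.norm_of_nonneg (by positivity)]
    calc 1 / r * ‖weightSeries τ T (1 + 1 / r)‖ ≤ 1 / r * (‖T‖ * latticeZeta (1 + 1 / r)) := by
          gcongr
          exact norm_weightSeries_le (lt_add_of_pos_right 1 (by positivity)) T
      _ = ‖T‖ * (1 / r * latticeZeta (1 + 1 / r)) := by ring
      _ ≤ ‖T‖ * 3 := by gcongr
  · rw [Set.indicator_of_notMem hr, norm_zero]
    positivity

variable (ω : GeneralizedLimit)

lemma exists_hasLim_weightedZeta [NeZero n] (T : HilbSpace τ →L[ℂ] HilbSpace τ) :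
    ∃ c : ℂ, ω.HasLim (fun r => weightedZeta τ T (1 + 1 / r)) c := by
  obtain ⟨R, _, hR⟩ := exists_memLp_weightedZeta T
  exact ⟨_, GeneralizedLimit.hasLim_of_memLp hR⟩

lemma weightedZeta_leftRep [NeZero n] {s : ℝ} (hs : 1 < s) (a : CuntzAlgebra n) :
    weightedZeta τ (leftRep τ a) s = kms τ a * (((s - 1) * latticeZeta s : ℝ) : ℂ) := by
  rw [weightedZeta_eq hs, weightSeries_leftRep]
  push_cast
  ring

lemma hasLim_leftRep [NeZero n] (a : CuntzAlgebra n) :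
    ω.HasLim (fun r => weightedZeta τ (leftRep τ a) (1 + 1 / r)) (kms τ a * 2) := by
  obtain ⟨R, hR0, hR⟩ := exists_memLp_weightedZeta (leftRep τ 1)
  have h1 : ∀ r : ℝ, 0 < r → ∀ b : CuntzAlgebra n, weightedZeta τ (leftRep τ b) (1 + 1 / r) =
      kms τ b * ((1 / r * latticeZeta (1 + 1 / r) : ℝ) : ℂ) := fun r hr b => by
    rw [weightedZeta_leftRep (lt_add_of_pos_right 1 (by positivity)), add_sub_cancel_left]
  have h2 : (Set.Ioi R).indicator (fun r => weightedZeta τ (leftRep τ 1) (1 + 1 / r)) =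
      (Set.Ioi R).indicator fun r => ((1 / r * latticeZeta (1 + 1 / r) : ℝ) : ℂ) :=
    Set.indicator_congr fun r hr => by rw [h1 r (hR0.trans hr), kms_one, one_mul]
  rw [h2] at hR
  have h3 := (GeneralizedLimit.hasLim_of_tendsto (ω := ω) hR
    tendsto_mul_latticeZeta_atTop).const_mul (kms τ a)
  rw [Complex.ofReal_ofNat] at h3
  refine h3.congr ?_
  filter_upwards [eventually_gt_atTop 0] with r hr
  rw [h1 r hr]

lemma tauHat_leftRep [NeZero n] {a : CuntzAlgebra n}
    (ha : leftRep τ a ∈ (cuntzVN τ).toStarSubalgebra) :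
    tauHat τ ω ⟨leftRep τ a, ha⟩ = kms τ a := by
  rw [tauHat, (hasLim_leftRep ω a).lim_eq]
  ring

lemma isState_tauHat [NeZero n] : IsState (cuntzVN τ) (tauHat τ ω) where
  map_add S T := by
    obtain ⟨c, hc⟩ := exists_hasLim_weightedZeta ω (S : HilbSpace τ →L[ℂ] HilbSpace τ)
    obtain ⟨d, hd⟩ := exists_hasLim_weightedZeta ω (T : HilbSpace τ →L[ℂ] HilbSpace τ)
    have h : ω.HasLim (fun r => weightedZeta τ (S + T : HilbSpace τ →L[ℂ] HilbSpace τ) (1 + 1 / r))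
        (c + d) := (hc.add hd).congr <| by
      filter_upwards [eventually_gt_atTop 0] with r hr
      rw [weightedZeta_one_add hr, weightedZeta_one_add hr, weightedZeta_one_add hr,
        weightSeries_add (lt_add_of_pos_right 1 (by positivity)), mul_add]
    rw [tauHat, tauHat, tauHat, hc.lim_eq, hd.lim_eq, ← mul_add]
    exact congrArg _ h.lim_eq
  map_smul c T := by
    obtain ⟨d, hd⟩ := exists_hasLim_weightedZeta ω (T : HilbSpace τ →L[ℂ] HilbSpace τ)
    have h : ω.HasLim (fun r => weightedZeta τ (c • T : HilbSpace τ →L[ℂ] HilbSpace τ) (1 + 1 / r))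
        (c * d) := (hd.const_mul c).congr <| by
      filter_upwards [eventually_gt_atTop 0] with r hr
      rw [weightedZeta_one_add hr, weightedZeta_one_add hr, weightSeries_smul, mul_left_comm]
    rw [tauHat, tauHat, hd.lim_eq, mul_left_comm]
    exact congrArg _ h.lim_eq
  nonneg T hT := by
    obtain ⟨R, hR0, hR⟩ := exists_memLp_weightedZeta (T : HilbSpace τ →L[ℂ] HilbSpace τ)
    have h := GeneralizedLimit.hasLim_of_memLp (ω := ω) hR
    rw [tauHat, h.lim_eq]
    refine mul_nonneg (by simp) (h.nonneg hR fun r hr => ?_)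
    have hr0 : 0 < r := hR0.trans hr
    rw [weightedZeta_one_add hr0]
    exact mul_nonneg (Complex.zero_le_real.2 (by positivity)) (weightSeries_nonneg _ hT)
  map_one := by
    have h1 := tauHat_leftRep (τ := τ) ω (leftRep_mem_cuntzVN 1)
    rw [kms_one] at h1
    rw [← h1]
    congr 1
    exact Subtype.ext (map_one (leftRep τ)).symm

end State

end Cuntz

end

theorem proposition3p14 (n : ℕ) (hn : 2 ≤ n) (τ : Cuntz.FaithfulTrace n)
    (ω : Cuntz.GeneralizedLimit) :
    (∀ T ∈ Cuntz.cuntzVN τ, ∀ s : ℝ, 1 < s → ∃ c : ℂ,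
      Tendsto (fun N : ℕ => Cuntz.tauTilde τ
        (Cuntz.modularCut τ N * (T * Cuntz.resolventPow τ s))) atTop (𝓝 c)) ∧
    (∀ T ∈ Cuntz.cuntzVN τ, ∃ c : ℂ,
      ω.HasLim (fun r => Cuntz.weightedZeta τ T (1 + 1 / r)) c) ∧
    Cuntz.IsState (Cuntz.cuntzVN τ) (Cuntz.tauHat τ ω) ∧
    ∀ a : Cuntz.CuntzAlgebra n, ∃ ha : Cuntz.leftRep τ a ∈ (Cuntz.cuntzVN τ).toStarSubalgebra,
      Tendsto (fun s : ℝ => 1 / 2 * Cuntz.weightedZeta τ (Cuntz.leftRep τ a) s)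
        (𝓝[>] 1) (𝓝 (τ.toLinearMap (Cuntz.condExp n a))) ∧
      Cuntz.tauHat τ ω ⟨Cuntz.leftRep τ a, ha⟩ = τ.toLinearMap (Cuntz.condExp n a) := by
  have : NeZero n := ⟨by omega⟩
  refine ⟨fun T _ s hs => ⟨_, Cuntz.tendsto_tauTilde hs T⟩,
    fun T _ => Cuntz.exists_hasLim_weightedZeta ω T, Cuntz.isState_tauHat ω,
    fun a => ⟨Cuntz.leftRep_mem_cuntzVN a, ?_, Cuntz.tauHat_leftRep ω _⟩⟩
  have h := ((Complex.continuous_ofReal.tendsto 2).comp Cuntz.tendsto_mul_latticeZeta).const_mul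
    (1 / 2 * Cuntz.kms τ a)
  have h2 : 1 / 2 * Cuntz.kms τ a * ((2 : ℝ) : ℂ) = τ.toLinearMap (Cuntz.condExp n a) := by
    rw [Complex.ofReal_ofNat, Cuntz.kms_apply]
    ring
  rw [h2] at h
  refine h.congr' ?_
  filter_upwards [self_mem_nhdsWithin] with s hs
  rw [Cuntz.weightedZeta_leftRep hs, Function.comp_apply, mul_assoc]
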